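/- Let $(A,\mathfrak m)$ be a Gorenstein local ring (a Noetherian local ring of finite injective dimension over itself) and let $I$ be a proper ideal of $A$ of grade $g$, minimally generated by $\mathbf u=u_1,\dots,u_m$. Let $K_\bullet(\mathbf u)$ be the Koszul complex of $\mathbf u$ over $A$, and put $H_i(I)=H_i(K_\bullet(\mathbf u))$ and $H^i(I)=H^i(\operatorname{Hom}_A(K_\bullet(\mathbf u),A))$; up to isomorphism these do not depend on the choice of the minimal generators. Let $r\ge 1$ and assume that $H_i(I)$ is a Cohen–Macaulay $A$-module for $i=0,\dots,r-1$ (the zero module counts as Cohen–Macaulay). Then there is an isomorphism of $A$-modules $$H^{r+g}(I)\;\cong\;\operatorname{Ext}^g_A(H_r(I),A).$$ In particular $H^{r+g}(I)$ is annihilated by $I$ and satisfies Serre's condition $S_2$ as an $A/I$-module, that is, $$\operatorname{depth}_{(A/I)_{\mathfrak p}} H^{r+g}(I)_{\mathfrak p}\;\ge\;\min\{2,\dim (A/I)_{\mathfrak p}\}$$ for every prime ideal $\mathfrak p$ of $A/I$, where the zero module has depth $\infty$. -/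

import Mathlib

open CategoryTheory

universe u

noncomputable section

namespace KoszulHomology

/-! ### The Koszul complex -/

section Koszul

variable {A : Type u} [CommRing A] {M : Type u} [AddCommGroup M] [Module A M]

/-- Contraction with a linear form lowers the degree in the exterior algebra by one. -/
theorem contractLeft_mem_exteriorPower (f : Module.Dual A M) (n : ℕ) (x : ExteriorAlgebra A M)
    (hx : x ∈ ⋀[A]^(n + 1) M) :
    CliffordAlgebra.contractLeft (Q := (0 : QuadraticForm A M)) f x ∈ ⋀[A]^n M := by
  induction n generalizing x with
  | zero =>
    rw [zero_add, ExteriorAlgebra.exteriorPower, pow_one] at hx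
    obtain ⟨m, rfl⟩ := hx
    rw [ExteriorAlgebra.exteriorPower, pow_zero]
    exact Submodule.mem_one.mpr ⟨f m, (CliffordAlgebra.contractLeft_ι _ f m).symm⟩
  | succ n ih =>
    rw [ExteriorAlgebra.exteriorPower, pow_succ'] at hx
    induction hx using Submodule.mul_induction_on' with
    | mem_mul_mem a ha b hb =>
      obtain ⟨m, rfl⟩ := ha
      rw [show ExteriorAlgebra.ι A m * b
        = CliffordAlgebra.ι (0 : QuadraticForm A M) m * b from rfl,
        CliffordAlgebra.contractLeft_ι_mul]
      refine Submodule.sub_mem _ (Submodule.smul_mem _ _ hb) ?_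
      rw [ExteriorAlgebra.exteriorPower, pow_succ']
      exact Submodule.mul_mem_mul ⟨m, rfl⟩ (ih b hb)
    | add x _ y _ hx hy => rw [map_add]; exact Submodule.add_mem _ hx hy

/-- The Koszul differential `⋀ⁿ⁺¹ M → ⋀ⁿ M` of a linear form `f : M → A`,
`x₀ ∧ ⋯ ∧ xₙ ↦ ∑ i, (-1)ⁱ f(xᵢ) x₀ ∧ ⋯ ∧ x̂ᵢ ∧ ⋯ ∧ xₙ`, that is, contraction with `f`
(characterised by `d(x ∧ y) = f(x) y - x ∧ d(y)` for `x` in `M`). -/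
def koszulD (f : Module.Dual A M) (n : ℕ) : ⋀[A]^(n + 1) M →ₗ[A] ⋀[A]^n M :=
  (CliffordAlgebra.contractLeft (Q := (0 : QuadraticForm A M)) f).restrict
    (contractLeft_mem_exteriorPower f n)

theorem koszulD_comp_koszulD (f : Module.Dual A M) (n : ℕ) :
    koszulD f n ∘ₗ koszulD f (n + 1) = 0 := by
  refine LinearMap.ext fun x => Subtype.ext ?_
  exact CliffordAlgebra.contractLeft_contractLeft f x.1

/-- The Koszul chain complex of a linear form `f : M → A`. -/
def koszulComplexOfDual (f : Module.Dual A M) : ChainComplex (ModuleCat.{u} A) ℕ :=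
  ChainComplex.of (fun n => ModuleCat.of A (⋀[A]^n M)) (fun n => ModuleCat.ofHom (koszulD f n))
    (fun n => by rw [← ModuleCat.ofHom_comp, koszulD_comp_koszulD]; rfl)

/-- The Koszul chain complex `K_•(u)` of a finite sequence `u = u₁, …, u_m` in `A`: the Koszul
complex of the linear form `A^m → A` that sends the `i`-th basis vector to `uᵢ`. -/
def koszulComplex {m : ℕ} (u : Fin m → A) : ChainComplex (ModuleCat.{u} A) ℕ :=
  koszulComplexOfDual (Fintype.linearCombination A u)

/-- The Koszul cochain complex `K^•(u) = Hom_A(K_•(u), A)`. -/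
def koszulCochainComplex {m : ℕ} (u : Fin m → A) : CochainComplex (ModuleCat.{u} A) ℕ :=
  (koszulComplex u).linearYonedaObj A (ModuleCat.of A A)

/-- Koszul homology `H_i(u)`. -/
def koszulHomology {m : ℕ} (u : Fin m → A) (i : ℕ) : ModuleCat.{u} A :=
  (koszulComplex u).homology i

/-- Koszul cohomology `H^i(u)`. -/
def koszulCohomology {m : ℕ} (u : Fin m → A) (i : ℕ) : ModuleCat.{u} A :=
  (koszulCochainComplex u).homology i

/-- `u = u₁, …, u_m` is a minimal system of generators of `I`: it generates `I`, and `m` is the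
least possible number of generators. -/
structure IsMinimalGenerators {m : ℕ} (u : Fin m → A) (I : Ideal A) : Prop where
  span_eq : Ideal.span (Set.range u) = I
  card_eq : m = Submodule.spanFinrank I

end Koszul

/-! ### Grade, depth, Cohen–Macaulay modules, Serre's condition, Gorenstein rings -/

section Depth

/-- `grade(I, M)`: the supremum of the lengths of `M`-regular sequences contained in `I`, equal to
`∞` when `IM = M`. Weakly regular sequences are used because for `IM ≠ M` a weakly regular
sequence in `I` is automatically regular, while for a finite module with `IM = M` (in particular
for `M = 0`) there are arbitrarily long ones. -/
def grade {A : Type*} [CommRing A] (I : Ideal A) (M : Type*) [AddCommGroup M] [Module A M] : ℕ∞ :=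
  ⨆ (rs : List A) (_ : ∀ r ∈ rs, r ∈ I) (_ : RingTheory.Sequence.IsWeaklyRegular M rs),
    (rs.length : ℕ∞)

/-- The depth of a (finite) module over a local ring `(A, 𝔪)`: `grade(𝔪, M)`; so `depth 0 = ∞`. -/
def depth (A : Type*) [CommRing A] [IsLocalRing A] (M : Type*) [AddCommGroup M] [Module A M] :
    ℕ∞ :=
  grade (IsLocalRing.maximalIdeal A) M

/-- A finite module `M` over a Noetherian local ring is Cohen–Macaulay if `M = 0` or
`depth M = dim M`. -/
def IsCohenMacaulay (A : Type*) [CommRing A] [IsLocalRing A] (M : Type*) [AddCommGroup M]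
    [Module A M] : Prop :=
  Subsingleton M ∨ (depth A M : WithBot ℕ∞) = Module.supportDim A M

/-- Serre's condition `S_n` for a finite `R`-module `M`: `depth M_p ≥ min (n, dim R_p)` for all
primes `p` of `R`. (If `M_p = 0` the depth is `∞` and the condition at `p` is empty.) -/
def SatisfiesSerre (n : ℕ) (R : Type*) [CommRing R] (M : Type*) [AddCommGroup M] [Module R M] :
    Prop :=
  ∀ (p : Ideal R) [p.IsPrime],
    min (n : WithBot ℕ∞) (ringKrullDim (Localization.AtPrime p)) ≤
      (depth (Localization.AtPrime p) (LocalizedModule p.primeCompl M) : WithBot ℕ∞)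

/-- A Gorenstein local ring: a Noetherian local ring of finite injective dimension over itself. -/
structure IsGorensteinLocalRing (A : Type u) [CommRing A] [IsLocalRing A] : Prop where
  isNoetherianRing : IsNoetherianRing A
  finite_injectiveDimension : ∃ n : ℕ, HasInjectiveDimensionLE (ModuleCat.of A A) n

end Depth

end KoszulHomology

end

/-! Let K be the Koszul complex, B_i and C_i the image and the cokernel of K_{i+1} → K_i, and d =
depth A. Each H_i is killed by I, which contains an A-regular sequence of length g, so Ext^j(H_i, A)
= 0 for j < g. Suppose also that Ext^j(H_i, A) = 0 for j > g and i < r. Dimension shifting along 0 →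
B_i → K_i → C_i → 0 and 0 → H_i → C_i → B_{i-1} → 0 then gives, for g > 0, H^{r+g} ≅
Ext^1(C_{r+g-1}, A) ≅ ... ≅ Ext^g(C_r, A) ≅ Ext^g(H_r, A); the case g = 0 is a direct argument with
Hom (`nonempty_cohomology_equiv_ext_homology`).

The vanishing above g uses that the injective dimension of A is d (`subsingleton_ext_of_length_lt`).
If N is Cohen–Macaulay and Ext^g(N, A) ≠ 0, Ischebeck's theorem gives depth N = dim N ≥ d - g.
Cutting N by a regular sequence of length d - g turns vanishing above d into vanishing above g
(`IsCohenMacaulay.subsingleton_ext`).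

It remains to see that Ext^g(H_i, A) ≠ 0 for i < r, unless H_i = 0. By induction on i the comparison
identifies it with H^{i+g}. If i + g ≤ m, rigidity of Koszul cohomology would turn its vanishing
into that of H^g ≅ Ext^g(H_0, A), contradicting grade I = g. If i + g > m, then H_i = 0 by the
acyclicity lemma.

For S_2, take an A-regular sequence xs of length g in I and put B = A/(xs). Then Ext^g(H_r, A) ≅
Hom(H_r, B), and B-regular sequences of length at most 2 stay regular on Hom(H_r, B). A prime P ⊇ I
contains B-regular sequences of every length up to ht P - g, because A is Cohen–Macaulay. -/

noncomputable section

namespace KoszulHomology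

/-! ### Long exact sequences of Ext for unbundled modules. -/

section ExtTools

open Abelian

variable {A : Type u} [CommRing A]

/-- `Ext^n_A(N, Y)` for unbundled modules. -/
abbrev ExtMod (A : Type u) [CommRing A] (N Y : Type u) [AddCommGroup N] [Module A N]
    [AddCommGroup Y] [Module A Y] (n : ℕ) : Type u :=
  Ext (ModuleCat.of A N) (ModuleCat.of A Y) n

variable {X₁ X₂ X₃ N Y : Type u} [AddCommGroup X₁] [Module A X₁] [AddCommGroup X₂] [Module A X₂]
  [AddCommGroup X₃] [Module A X₃] [AddCommGroup N] [Module A N] [AddCommGroup Y] [Module A Y]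
  {f : X₁ →ₗ[A] X₂} {g : X₂ →ₗ[A] X₃}

theorem shortExact_of_exact (hf : Function.Injective f) (hfg : Function.Exact f g)
    (hg : Function.Surjective g) :
    (ModuleCat.shortComplexOfCompEqZero f g hfg.linearMap_comp_eq_zero).ShortExact :=
  ModuleCat.shortComplex_shortExact _ hfg hf hg

/-- Precomposition with a linear map on `Ext`. -/
def extPrecomp (f : X₁ →ₗ[A] X₂) (Y : Type u) [AddCommGroup Y] [Module A Y] (n : ℕ) :
    ExtMod A X₂ Y n →ₗ[A] ExtMod A X₁ Y n :=
  (Ext.mk₀ (ModuleCat.ofHom f)).precompOfLinear A (ModuleCat.of A Y) (zero_add n)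

/-- The connecting map of the contravariant long exact sequence. -/
def extConnecting (hf : Function.Injective f) (hfg : Function.Exact f g)
    (hg : Function.Surjective g) (Y : Type u) [AddCommGroup Y] [Module A Y] (n : ℕ) :
    ExtMod A X₁ Y n →ₗ[A] ExtMod A X₃ Y (n + 1) :=
  (shortExact_of_exact hf hfg hg).extClass.precompOfLinear A (ModuleCat.of A Y) (add_comm 1 n)

section Contravariant

variable (hf : Function.Injective f) (hfg : Function.Exact f g) (hg : Function.Surjective g)
include hf hfg hg

theorem extPrecomp_exact (n : ℕ) : Function.Exact (extPrecomp g Y n) (extPrecomp f Y n) := by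
  intro x
  refine ⟨fun h => Ext.contravariant_sequence_exact₂ (shortExact_of_exact hf hfg hg) _ x h, ?_⟩
  rintro ⟨y, rfl⟩
  change (Ext.mk₀ _).comp ((Ext.mk₀ _).comp y (zero_add n)) (zero_add n) = 0
  rw [Ext.mk₀_comp_mk₀_assoc, ← ModuleCat.ofHom_comp, hfg.linearMap_comp_eq_zero]
  change (Ext.mk₀ 0).comp _ (zero_add n) = 0
  rw [Ext.mk₀_zero, Ext.zero_comp]

theorem extPrecomp_extConnecting_exact (n : ℕ) :
    Function.Exact (extPrecomp f Y n) (extConnecting hf hfg hg Y n) := by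
  intro x
  refine ⟨fun h => Ext.contravariant_sequence_exact₁ (shortExact_of_exact hf hfg hg) _ x
    (add_comm 1 n) h, ?_⟩
  rintro ⟨y, rfl⟩
  exact (shortExact_of_exact hf hfg hg).extClass_comp_assoc y (h := add_comm 1 n)

theorem extConnecting_extPrecomp_exact (n : ℕ) :
    Function.Exact (extConnecting hf hfg hg Y n) (extPrecomp g Y (n + 1)) := by
  intro x
  refine ⟨fun h => Ext.contravariant_sequence_exact₃ (shortExact_of_exact hf hfg hg) _ x h
    (add_comm 1 n), ?_⟩
  rintro ⟨y, rfl⟩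
  exact (shortExact_of_exact hf hfg hg).comp_extClass_assoc y (add_comm 1 n)

theorem subsingleton_ext_middle (n : ℕ) [Subsingleton (ExtMod A X₁ Y n)]
    [Subsingleton (ExtMod A X₃ Y n)] : Subsingleton (ExtMod A X₂ Y n) := by
  refine subsingleton_of_forall_eq 0 fun x => ?_
  obtain ⟨y, rfl⟩ := (extPrecomp_exact hf hfg hg n x).1 (Subsingleton.elim _ _)
  rw [Subsingleton.elim y 0, map_zero]

theorem subsingleton_ext_left (n : ℕ) [Subsingleton (ExtMod A X₂ Y n)]
    [Subsingleton (ExtMod A X₃ Y (n + 1))] : Subsingleton (ExtMod A X₁ Y n) := by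
  refine subsingleton_of_forall_eq 0 fun x => ?_
  obtain ⟨y, rfl⟩ := (extPrecomp_extConnecting_exact hf hfg hg n x).1 (Subsingleton.elim _ _)
  rw [Subsingleton.elim y 0, map_zero]

theorem subsingleton_ext_right (n : ℕ) [Subsingleton (ExtMod A X₁ Y n)]
    [Subsingleton (ExtMod A X₂ Y (n + 1))] : Subsingleton (ExtMod A X₃ Y (n + 1)) := by
  refine subsingleton_of_forall_eq 0 fun x => ?_
  obtain ⟨y, rfl⟩ := (extConnecting_extPrecomp_exact hf hfg hg n x).1 (Subsingleton.elim _ _)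
  rw [Subsingleton.elim y 0, map_zero]

theorem extConnecting_surjective (n : ℕ) [Subsingleton (ExtMod A X₂ Y (n + 1))] :
    Function.Surjective (extConnecting hf hfg hg Y n) := fun x =>
  (extConnecting_extPrecomp_exact hf hfg hg n x).1 (Subsingleton.elim _ _)

theorem extConnecting_injective (n : ℕ) [Subsingleton (ExtMod A X₂ Y n)] :
    Function.Injective (extConnecting hf hfg hg Y n) := by
  refine (injective_iff_map_eq_zero _).2 fun x hx => ?_
  obtain ⟨y, rfl⟩ := (extPrecomp_extConnecting_exact hf hfg hg n x).1 hx
  rw [Subsingleton.elim y 0, map_zero]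

theorem extPrecomp_left_surjective (n : ℕ) [Subsingleton (ExtMod A X₃ Y (n + 1))] :
    Function.Surjective (extPrecomp f Y n) := fun x =>
  (extPrecomp_extConnecting_exact hf hfg hg n x).1 (Subsingleton.elim _ _)

theorem extPrecomp_left_injective (n : ℕ) [Subsingleton (ExtMod A X₃ Y n)] :
    Function.Injective (extPrecomp f Y n) := by
  refine (injective_iff_map_eq_zero _).2 fun x hx => ?_
  obtain ⟨y, rfl⟩ := (extPrecomp_exact hf hfg hg n x).1 hx
  rw [Subsingleton.elim y 0, map_zero]

theorem extPrecomp_right_surjective (n : ℕ) [Subsingleton (ExtMod A X₁ Y n)] :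
    Function.Surjective (extPrecomp g Y n) := fun x =>
  (extPrecomp_exact hf hfg hg n x).1 (Subsingleton.elim _ _)

theorem extPrecomp_right_injective (n : ℕ) [Subsingleton (ExtMod A X₁ Y n)] :
    Function.Injective (extPrecomp g Y (n + 1)) := by
  refine (injective_iff_map_eq_zero _).2 fun x hx => ?_
  obtain ⟨y, rfl⟩ := (extConnecting_extPrecomp_exact hf hfg hg n x).1 hx
  rw [Subsingleton.elim y 0, map_zero]

theorem subsingleton_ext_covariant_right (n : ℕ) [Subsingleton (ExtMod A N X₂ n)]
    [Subsingleton (ExtMod A N X₁ (n + 1))] : Subsingleton (ExtMod A N X₃ n) := by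
  refine subsingleton_of_forall_eq 0 fun x => ?_
  obtain ⟨y, rfl⟩ := Ext.covariant_sequence_exact₃ (ModuleCat.of A N)
    (shortExact_of_exact hf hfg hg) x rfl (Subsingleton.elim _ _)
  rw [show y = 0 from Subsingleton.elim (α := ExtMod A N X₂ n) _ _, Ext.zero_comp]

end Contravariant

/-- `Ext⁰ = Hom`. -/
def extZeroEquiv (N Y : Type u) [AddCommGroup N] [Module A N] [AddCommGroup Y] [Module A Y] :
    ExtMod A N Y 0 ≃ₗ[A] (N →ₗ[A] Y) :=
  Ext.linearEquiv₀.trans ModuleCat.homLinearEquiv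

theorem extPrecomp_extZeroEquiv_symm (f : X₁ →ₗ[A] X₂) (φ : X₂ →ₗ[A] Y) :
    extPrecomp f Y 0 ((extZeroEquiv X₂ Y).symm φ) = (extZeroEquiv X₁ Y).symm (φ ∘ₗ f) := by
  change (Ext.mk₀ (ModuleCat.ofHom f)).comp (Ext.mk₀ (ModuleCat.ofHom φ)) (zero_add 0)
    = Ext.mk₀ (ModuleCat.ofHom (φ ∘ₗ f))
  rw [Ext.mk₀_comp_mk₀, ModuleCat.ofHom_comp]

theorem subsingleton_ext_of_projective [Module.Projective A N] (n : ℕ) :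
    Subsingleton (ExtMod A N Y (n + 1)) :=
  have := IsProjective.iff_projective N |>.1 (inferInstance : Module.Projective A N)
  Ext.subsingleton_of_projective _ _ n

/-- `Ext` only depends on the first argument up to isomorphism. -/
def extCongr (e : X₁ ≃ₗ[A] X₂) (n : ℕ) : ExtMod A X₂ Y n ≃ₗ[A] ExtMod A X₁ Y n :=
  LinearEquiv.ofLinearMap (extPrecomp e.toLinearMap Y n) (extPrecomp e.symm.toLinearMap Y n)
    (by
      ext x
      change (Ext.mk₀ _).comp ((Ext.mk₀ _).comp x (zero_add n)) (zero_add n) = x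
      rw [Ext.mk₀_comp_mk₀_assoc, ← ModuleCat.ofHom_comp, LinearEquiv.symm_comp]
      exact Ext.mk₀_id_comp x)
    (by
      ext x
      change (Ext.mk₀ _).comp ((Ext.mk₀ _).comp x (zero_add n)) (zero_add n) = x
      rw [Ext.mk₀_comp_mk₀_assoc, ← ModuleCat.ofHom_comp, LinearEquiv.comp_symm]
      exact Ext.mk₀_id_comp x)

theorem subsingleton_ext_of_subsingleton [Subsingleton N] (n : ℕ) :
    Subsingleton (ExtMod A N Y n) := by
  refine subsingleton_of_forall_eq 0 fun x => ?_
  rw [← Ext.mk₀_id_comp x, show 𝟙 (ModuleCat.of A N) = 0 from ?_, Ext.mk₀_zero, Ext.zero_comp]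
  ext y
  exact Subsingleton.elim _ _

theorem extPrecomp_smul_id (a : A) (n : ℕ) :
    extPrecomp (a • (LinearMap.id : N →ₗ[A] N)) Y n = a • LinearMap.id := by
  ext x
  change (Ext.mk₀ (a • 𝟙 (ModuleCat.of A N))).comp x (zero_add n) = a • x
  rw [Ext.mk₀_smul, Ext.smul_comp, Ext.mk₀_id_comp]

theorem smul_ext_eq_zero_of_smul_eq_zero {a : A} (ha : ∀ x : N, a • x = 0) (n : ℕ)
    (x : ExtMod A N Y n) : a • x = 0 := by
  have h : a • (LinearMap.id : N →ₗ[A] N) = 0 := LinearMap.ext ha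
  have := LinearMap.congr_fun (extPrecomp_smul_id (N := N) (Y := Y) a n) x
  rw [h] at this
  rw [show a • x = (a • LinearMap.id : ExtMod A N Y n →ₗ[A] _) x from rfl, ← this]
  change (Ext.mk₀ 0).comp x (zero_add n) = 0
  rw [Ext.mk₀_zero, Ext.zero_comp]

open Pointwise in
theorem subsingleton_ext_quotSMulTop {a : A} (ha : IsSMulRegular Y a) (n : ℕ)
    [Subsingleton (ExtMod A N Y n)] [Subsingleton (ExtMod A N Y (n + 1))] :
    Subsingleton (ExtMod A N (QuotSMulTop a Y) n) :=
  subsingleton_ext_covariant_right (f := LinearMap.lsmul A Y a)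
    (g := (a • (⊤ : Submodule A Y)).mkQ) ha (LinearMap.exact_lsmul_mkQ_smul_top Y a)
    (Submodule.mkQ_surjective _) n

/-- If `a` is `Y`-regular and kills `N`, and `Ext^n(N, Y) = 0`, then
`Ext^n(N, Y/aY) ≃ Ext^{n+1}(N, Y)`. -/
def extQuotSMulTopEquiv {a : A} (ha : IsSMulRegular Y a) (haN : ∀ x : N, a • x = 0) (n : ℕ)
    [Subsingleton (ExtMod A N Y n)] :
    ExtMod A N (QuotSMulTop a Y) n ≃ₗ[A] ExtMod A N Y (n + 1) :=
  LinearEquiv.ofBijective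
    ((IsSMulRegular.smulShortComplex_shortExact (M := ModuleCat.of A Y) ha).extClass.postcompOfLinear
      A (ModuleCat.of A N) rfl) <| by
    constructor
    · refine (injective_iff_map_eq_zero _).2 fun x hx => ?_
      obtain ⟨y, rfl⟩ := Ext.covariant_sequence_exact₃ (ModuleCat.of A N)
        (IsSMulRegular.smulShortComplex_shortExact (M := ModuleCat.of A Y) ha) x rfl hx
      rw [show y = 0 from Subsingleton.elim (α := ExtMod A N Y n) _ _, Ext.zero_comp]
    · intro x
      -- Multiplication by a on Ext^{n+1}(N, Y) is zero because a kills N, so the connecting map is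
      -- onto.
      refine Ext.covariant_sequence_exact₁ (ModuleCat.of A N)
        (IsSMulRegular.smulShortComplex_shortExact (M := ModuleCat.of A Y) ha) x ?_ rfl
      refine (Ext.smul_eq_comp_mk₀ (R := A) (X := ModuleCat.of A N) (Y := ModuleCat.of A Y)
        x a).symm.trans ?_
      exact smul_ext_eq_zero_of_smul_eq_zero haN _ x

end ExtTools

/-! ### Cohomology of the dual of a projective complex via Ext of its homology. -/

section LinearComplex

open Abelian

variable {A : Type u} [CommRing A] {K : ℕ → Type u} [∀ n, AddCommGroup (K n)]
  [∀ n, Module A (K n)] (d : ∀ n, K (n + 1) →ₗ[A] K n)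
  (Y : Type u) [AddCommGroup Y] [Module A Y]

/-- The cycles of a chain complex of modules given by its differentials. -/
def cyclesOf : ∀ n, Submodule A (K n)
  | 0 => ⊤
  | n + 1 => LinearMap.ker (d n)

/-- The homology of a chain complex of modules given by its differentials. -/
abbrev HomologyOf (n : ℕ) : Type u :=
  cyclesOf d n ⧸ (LinearMap.range (d n)).submoduleOf (cyclesOf d n)

/-- The cokernel of the differential with target `K n`. -/
abbrev CokerOf (n : ℕ) : Type u := K n ⧸ LinearMap.range (d n)

/-- The coboundaries of the complex `Hom(K, Y)`. -/
def coboundariesOf : ∀ n, Submodule A (K n →ₗ[A] Y)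
  | 0 => ⊥
  | n + 1 => LinearMap.range (LinearMap.lcomp A Y (d n))

/-- The cocycles of the complex `Hom(K, Y)`. -/
abbrev cocyclesOf (n : ℕ) : Submodule A (K n →ₗ[A] Y) := LinearMap.ker (LinearMap.lcomp A Y (d n))

/-- The cohomology of the complex `Hom(K, Y)`. -/
abbrev CohomologyOf (n : ℕ) : Type u :=
  cocyclesOf d Y n ⧸ (coboundariesOf d Y n).submoduleOf (cocyclesOf d Y n)

/-- The inclusion of the homology into the cokernel of the differential. -/
def homologyToCoker (n : ℕ) : HomologyOf d n →ₗ[A] CokerOf d n :=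
  Submodule.mapQ _ _ (cyclesOf d n).subtype le_rfl

/-- The map from the cokernel of the differential to the boundaries one degree below. -/
def cokerToRange (hd : ∀ n, d n ∘ₗ d (n + 1) = 0) (n : ℕ) :
    CokerOf d (n + 1) →ₗ[A] LinearMap.range (d n) :=
  Submodule.liftQ _ (d n).rangeRestrict <| by
    rintro _ ⟨x, rfl⟩
    exact Subtype.ext (LinearMap.congr_fun (hd n) x)

variable {d Y}

theorem homologyToCoker_injective (n : ℕ) : Function.Injective (homologyToCoker d n) := by
  refine (injective_iff_map_eq_zero _).2 fun x => ?_
  obtain ⟨x, rfl⟩ := Submodule.mkQ_surjective _ x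
  intro h
  exact (Submodule.Quotient.mk_eq_zero _).2 ((Submodule.Quotient.mk_eq_zero (LinearMap.range (d n))).1 h)

theorem homologyToCoker_zero_surjective : Function.Surjective (homologyToCoker d 0) := by
  intro x
  obtain ⟨x, rfl⟩ := Submodule.mkQ_surjective _ x
  exact ⟨Submodule.mkQ _ ⟨x, trivial⟩, rfl⟩

/-- In degree zero the homology is the cokernel of the differential. -/
def homologyZeroEquiv : HomologyOf d 0 ≃ₗ[A] CokerOf d 0 :=
  LinearEquiv.ofBijective _ ⟨homologyToCoker_injective 0, homologyToCoker_zero_surjective⟩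

variable (hd : ∀ n, d n ∘ₗ d (n + 1) = 0)

theorem cokerToRange_surjective (n : ℕ) : Function.Surjective (cokerToRange d hd n) := by
  rintro ⟨_, x, rfl⟩
  exact ⟨Submodule.mkQ _ x, rfl⟩

theorem homologyToCoker_exact (n : ℕ) :
    Function.Exact (homologyToCoker d (n + 1)) (cokerToRange d hd n) := by
  intro x
  obtain ⟨x, rfl⟩ := Submodule.mkQ_surjective _ x
  constructor
  · intro h
    exact ⟨Submodule.mkQ _ ⟨x, congrArg Subtype.val h⟩, rfl⟩
  · rintro ⟨y, hy⟩
    obtain ⟨y, rfl⟩ := Submodule.mkQ_surjective _ y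
    rw [← hy]
    exact Subtype.ext y.2

section ExtVanishing

variable [∀ n, Module.Projective A (K n)]

/-- Dimension shift through the projective K_n. The degree j + 1 is positive because Hom(K_n, Y)
need not vanish. -/
theorem subsingleton_ext_range_of_coker (n j : ℕ)
    (h : Subsingleton (ExtMod A (CokerOf d n) Y (j + 2))) :
    Subsingleton (ExtMod A (LinearMap.range (d n)) Y (j + 1)) :=
  have := subsingleton_ext_of_projective (A := A) (N := K n) (Y := Y) j
  subsingleton_ext_left (Submodule.injective_subtype _) (LinearMap.exact_subtype_mkQ _)
    (Submodule.mkQ_surjective _) (j + 1)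

include hd in
-- By induction, C_{i+1} is an extension of B_i by H_{i+1}, and Ext^j(B_i, Y) vanishes once
-- Ext^{j+1}(C_i, Y) does.
theorem subsingleton_ext_coker {g r : ℕ}
    (hhigh : ∀ i < r, ∀ j, g < j → Subsingleton (ExtMod A (HomologyOf d i) Y j))
    {i : ℕ} (hi : i < r) {j : ℕ} (hj : g < j) : Subsingleton (ExtMod A (CokerOf d i) Y j) := by
  induction i generalizing j with
  | zero =>
    have := hhigh 0 hi j hj
    exact (extCongr (Y := Y) homologyZeroEquiv.symm j).symm.injective.subsingleton
  | succ i ih =>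
    obtain ⟨j, rfl⟩ := Nat.exists_eq_add_of_lt hj
    have := hhigh (i + 1) hi _ hj
    have := subsingleton_ext_range_of_coker i (g + j) (ih (Nat.lt_of_succ_lt hi) (by omega))
    exact subsingleton_ext_middle (homologyToCoker_injective (i + 1)) (homologyToCoker_exact hd i)
      (cokerToRange_surjective hd i) _

include hd in
-- The kernel and cokernel of restriction from C_r to H_r are controlled by Ext(B_{r-1}, Y) in
-- degrees g + 1 and g + 2, which shift to vanishing groups of C_{r-1}. The single degree is written
-- g + 1 because the shift needs positive degrees.
theorem nonempty_extCoker_equiv_extHomology {g r : ℕ}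
    (hhigh : ∀ i < r, ∀ j, g + 1 < j → Subsingleton (ExtMod A (HomologyOf d i) Y j)) :
    Nonempty (ExtMod A (CokerOf d r) Y (g + 1) ≃ₗ[A] ExtMod A (HomologyOf d r) Y (g + 1)) := by
  cases r with
  | zero => exact ⟨extCongr homologyZeroEquiv (g + 1)⟩
  | succ r =>
    have := subsingleton_ext_range_of_coker (Y := Y) r (g + 1)
      (subsingleton_ext_coker hd hhigh r.lt_succ_self (by omega))
    have := subsingleton_ext_range_of_coker (Y := Y) r g
      (subsingleton_ext_coker hd hhigh r.lt_succ_self (by omega))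
    exact ⟨LinearEquiv.ofBijective _
      ⟨extPrecomp_left_injective (homologyToCoker_injective (r + 1)) (homologyToCoker_exact hd r)
        (cokerToRange_surjective hd r) (g + 1),
      extPrecomp_left_surjective (homologyToCoker_injective (r + 1)) (homologyToCoker_exact hd r)
        (cokerToRange_surjective hd r) (g + 1)⟩⟩

include hd in
-- Both sides are Ext^{j+1}(B_i, Y): one because the neighbouring Ext groups of H_{i+1} vanish, the
-- other because K_i is projective.
theorem nonempty_extCoker_succ_equiv (i j : ℕ)
    (h₀ : Subsingleton (ExtMod A (HomologyOf d (i + 1)) Y j))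
    (h₁ : Subsingleton (ExtMod A (HomologyOf d (i + 1)) Y (j + 1))) :
    Nonempty (ExtMod A (CokerOf d (i + 1)) Y (j + 1) ≃ₗ[A] ExtMod A (CokerOf d i) Y (j + 2)) := by
  have := subsingleton_ext_of_projective (A := A) (N := K i) (Y := Y) j
  have := subsingleton_ext_of_projective (A := A) (N := K i) (Y := Y) (j + 1)
  exact ⟨(LinearEquiv.ofBijective _
    ⟨extPrecomp_right_injective (homologyToCoker_injective (i + 1)) (homologyToCoker_exact hd i)
      (cokerToRange_surjective hd i) j,
    extPrecomp_right_surjective (homologyToCoker_injective (i + 1)) (homologyToCoker_exact hd i)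
      (cokerToRange_surjective hd i) (j + 1)⟩).symm.trans
    (LinearEquiv.ofBijective _
    ⟨extConnecting_injective (Submodule.injective_subtype (LinearMap.range (d i)))
      (LinearMap.exact_subtype_mkQ _) (Submodule.mkQ_surjective _) (j + 1),
    extConnecting_surjective (Submodule.injective_subtype (LinearMap.range (d i)))
      (LinearMap.exact_subtype_mkQ _) (Submodule.mkQ_surjective _) (j + 1)⟩)⟩

include hd in
theorem nonempty_extOne_coker_equiv {g : ℕ}
    (hlow : ∀ i, ∀ j < g, Subsingleton (ExtMod A (HomologyOf d i) Y j)) (k i : ℕ) (hk : k < g) :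
    Nonempty (ExtMod A (CokerOf d (i + k)) Y 1 ≃ₗ[A] ExtMod A (CokerOf d i) Y (k + 1)) := by
  induction k generalizing i with
  | zero => exact ⟨LinearEquiv.refl _ _⟩
  | succ k ih =>
    obtain ⟨e⟩ := ih (i + 1) (by omega)
    obtain ⟨e'⟩ := nonempty_extCoker_succ_equiv (Y := Y) hd i k (hlow _ _ (by omega))
      (hlow _ _ (by omega))
    rw [show i + (k + 1) = i + 1 + k by omega]
    exact ⟨e.trans e'⟩

end ExtVanishing

theorem exists_eq_comp_rangeRestrict {M N P : Type*} [AddCommGroup M] [AddCommGroup N]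
    [AddCommGroup P] [Module A M] [Module A N] [Module A P] (f : M →ₗ[A] N) (x : M →ₗ[A] P)
    (h : LinearMap.ker f ≤ LinearMap.ker x) :
    ∃ φ : LinearMap.range f →ₗ[A] P, φ ∘ₗ f.rangeRestrict = x := by
  refine ⟨((LinearMap.ker f).liftQ x h).comp f.quotKerEquivRange.symm.toLinearMap, ?_⟩
  ext y
  have : f.quotKerEquivRange.symm (f.rangeRestrict y) = Submodule.Quotient.mk y := by
    rw [LinearEquiv.symm_apply_eq]
    rfl
  simp [this]

/-- A cocycle of `Hom(K, Y)` induces a map on homology. -/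
def cocycleToHomology (n : ℕ) : cocyclesOf d Y n →ₗ[A] (HomologyOf d n →ₗ[A] Y) where
  toFun x := Submodule.liftQ _ (x.1 ∘ₗ (cyclesOf d n).subtype) <| by
    rintro y ⟨z, hz⟩
    have := LinearMap.congr_fun (LinearMap.mem_ker.1 x.2) z
    change x.1 y.1 = 0
    rw [show y.1 = d n z from hz.symm]
    exact this
  map_add' x y := Submodule.linearMap_qext _ rfl
  map_smul' a x := Submodule.linearMap_qext _ rfl

theorem ker_le_ker_of_cocycleToHomology_eq_zero (n : ℕ) (x : cocyclesOf d Y (n + 1))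
    (hx : cocycleToHomology (n + 1) x = 0) : LinearMap.ker (d n) ≤ LinearMap.ker x.1 := fun y hy =>
  LinearMap.congr_fun hx (Submodule.Quotient.mk (⟨y, hy⟩ : cyclesOf d (n + 1)))

include hd in
theorem comp_rangeRestrict_mem_cocycles (n : ℕ) (φ : LinearMap.range (d n) →ₗ[A] Y) :
    φ ∘ₗ (d n).rangeRestrict ∈ cocyclesOf d Y (n + 1) := by
  rw [LinearMap.mem_ker]
  ext x
  change φ ((d n).rangeRestrict (d (n + 1) x)) = 0
  rw [show (d n).rangeRestrict (d (n + 1) x) = 0 from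
    Subtype.ext (LinearMap.congr_fun (hd n) x), map_zero]

/-- Functionals on the boundaries are the cocycles one degree above, if there are no functionals
on the homology. -/
def rangeDualEquivCocycles (n : ℕ) (h : Subsingleton (HomologyOf d (n + 1) →ₗ[A] Y)) :
    (LinearMap.range (d n) →ₗ[A] Y) ≃ₗ[A] cocyclesOf d Y (n + 1) :=
  LinearEquiv.ofBijective
    (LinearMap.codRestrict _ (LinearMap.lcomp A Y (d n).rangeRestrict)
      (comp_rangeRestrict_mem_cocycles hd n)) <| by
    constructor
    · intro φ ψ hφ
      ext ⟨_, y, rfl⟩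
      exact LinearMap.congr_fun (congrArg Subtype.val hφ) y
    · intro x
      obtain ⟨φ, hφ⟩ := exists_eq_comp_rangeRestrict (d n) x.1
        (ker_le_ker_of_cocycleToHomology_eq_zero n x (Subsingleton.elim _ _))
      exact ⟨φ, Subtype.ext hφ⟩

/-- Two submodules give isomorphic quotients if one of them is the kernel of a surjection. -/
theorem nonempty_quotient_equiv_of_ker_eq {M N : Type*} [AddCommGroup M] [AddCommGroup N]
    [Module A M] [Module A N] (f : M →ₗ[A] N) (hf : Function.Surjective f) (p : Submodule A M)
    (hp : ∀ x, f x = 0 ↔ x ∈ p) : Nonempty ((M ⧸ p) ≃ₗ[A] N) :=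
  ⟨(Submodule.quotEquivOfEq _ _ (Submodule.ext fun x => (hp x).symm)).trans
    (f.quotKerEquivOfSurjective hf)⟩

/-- The connecting class in Ext^1 is the obstruction to extending a functional; this translates
elementwise cochain conditions into Ext. -/
theorem exists_extend_of_extConnecting_eq_zero {X₁ X₂ X₃ : Type u} [AddCommGroup X₁] [Module A X₁]
    [AddCommGroup X₂] [Module A X₂] [AddCommGroup X₃] [Module A X₃] {f : X₁ →ₗ[A] X₂}
    {g : X₂ →ₗ[A] X₃} (hf : Function.Injective f) (hfg : Function.Exact f g)
    (hg : Function.Surjective g) (φ : X₁ →ₗ[A] Y) :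
    extConnecting hf hfg hg Y 0 ((extZeroEquiv X₁ Y).symm φ) = 0 ↔
      ∃ ψ : X₂ →ₗ[A] Y, ψ ∘ₗ f = φ := by
  rw [extPrecomp_extConnecting_exact hf hfg hg 0]
  constructor
  · rintro ⟨y, hy⟩
    obtain ⟨ψ, rfl⟩ := (extZeroEquiv X₂ Y).symm.surjective y
    rw [extPrecomp_extZeroEquiv_symm] at hy
    exact ⟨ψ, (extZeroEquiv X₁ Y).symm.injective hy⟩
  · rintro ⟨ψ, rfl⟩
    exact ⟨_, extPrecomp_extZeroEquiv_symm f ψ⟩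

section CohomologyComparison

variable [∀ n, Module.Projective A (K n)]

include hd in
-- With no functionals on H_{n+1}, cocycles are functionals on B_n, and coboundaries are those that
-- extend to K_n. The quotient is the cokernel of Hom(K_n, Y) → Hom(B_n, Y).
theorem nonempty_cohomology_equiv_extOne_coker (n : ℕ)
    (h : Subsingleton (HomologyOf d (n + 1) →ₗ[A] Y)) :
    Nonempty (CohomologyOf d Y (n + 1) ≃ₗ[A] ExtMod A (CokerOf d n) Y 1) := by
  have := subsingleton_ext_of_projective (A := A) (N := K n) (Y := Y) 0
  let e := rangeDualEquivCocycles hd n h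
  let c := extConnecting (Submodule.injective_subtype (LinearMap.range (d n)))
      (LinearMap.exact_subtype_mkQ _) (Submodule.mkQ_surjective _) Y 0
  have hc : Function.Surjective c := extConnecting_surjective _ _ _ 0
  refine nonempty_quotient_equiv_of_ker_eq
    (c ∘ₗ (extZeroEquiv _ Y).symm.toLinearMap ∘ₗ e.symm.toLinearMap)
    (hc.comp ((extZeroEquiv _ Y).symm.surjective.comp e.symm.surjective)) _ fun x => ?_
  obtain ⟨φ, rfl⟩ := e.surjective x
  simp only [LinearMap.comp_apply, LinearEquiv.coe_coe, LinearEquiv.symm_apply_apply]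
  refine (exists_extend_of_extConnecting_eq_zero _ _ _ φ).trans ?_
  constructor
  · rintro ⟨ψ, rfl⟩
    exact ⟨ψ, rfl⟩
  · rintro ⟨ψ, hψ⟩
    refine ⟨ψ, ?_⟩
    ext ⟨_, y, rfl⟩
    exact LinearMap.congr_fun hψ y

omit [∀ n, Module.Projective A (K n)] in
theorem nonempty_cohomology_zero_equiv :
    Nonempty (CohomologyOf d Y 0 ≃ₗ[A] (HomologyOf d 0 →ₗ[A] Y)) := by
  refine nonempty_quotient_equiv_of_ker_eq (cocycleToHomology 0) (fun η => ?_) _ fun x => ?_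
  · refine ⟨⟨η ∘ₗ homologyZeroEquiv.symm.toLinearMap ∘ₗ (LinearMap.range (d 0)).mkQ, ?_⟩, ?_⟩
    · rw [LinearMap.mem_ker]
      ext y
      change η (homologyZeroEquiv.symm ((LinearMap.range (d 0)).mkQ (d 0 y))) = 0
      rw [show (LinearMap.range (d 0)).mkQ (d 0 y) = 0 from
        (Submodule.Quotient.mk_eq_zero _).2 ⟨y, rfl⟩, map_zero, map_zero]
    · refine Submodule.linearMap_qext _ (LinearMap.ext fun z => ?_)
      change η (homologyZeroEquiv.symm (homologyZeroEquiv (Submodule.Quotient.mk z))) = _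
      rw [LinearEquiv.symm_apply_apply]
      rfl
  · constructor
    · intro h
      change x.1 = 0
      ext y
      exact LinearMap.congr_fun h (Submodule.Quotient.mk (⟨y, trivial⟩ : cyclesOf d 0))
    · intro h
      have h : x.1 = 0 := h
      rw [show x = 0 from Subtype.ext h, map_zero]

include hd in
-- The case g = 0. Functionals on H_{n+1} extend to C_{n+1} since Ext^1(B_n, Y) = 0; a cocycle
-- vanishing on homology factors through B_n and extends to K_n since Ext^1(C_n, Y) = 0.
theorem nonempty_cohomology_equiv_homology_dual (n : ℕ)
    (h₁ : Subsingleton (ExtMod A (CokerOf d n) Y 1))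
    (h₂ : Subsingleton (ExtMod A (CokerOf d n) Y 2)) :
    Nonempty (CohomologyOf d Y (n + 1) ≃ₗ[A] (HomologyOf d (n + 1) →ₗ[A] Y)) := by
  have := subsingleton_ext_range_of_coker n 0 h₂
  refine nonempty_quotient_equiv_of_ker_eq (cocycleToHomology (n + 1)) (fun η => ?_) _ fun x => ?_
  · obtain ⟨ψ, hψ⟩ := (exists_extend_of_extConnecting_eq_zero (homologyToCoker_injective (n + 1))
      (homologyToCoker_exact hd n) (cokerToRange_surjective hd n) η).1 (Subsingleton.elim _ _)
    refine ⟨⟨ψ ∘ₗ (LinearMap.range (d (n + 1))).mkQ, ?_⟩, ?_⟩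
    · rw [LinearMap.mem_ker]
      ext y
      change ψ ((LinearMap.range (d (n + 1))).mkQ (d (n + 1) y)) = 0
      rw [show (LinearMap.range (d (n + 1))).mkQ (d (n + 1) y) = 0 from
        (Submodule.Quotient.mk_eq_zero _).2 ⟨y, rfl⟩, map_zero]
    · rw [← hψ]
      exact Submodule.linearMap_qext _ rfl
  · constructor
    · intro hx
      obtain ⟨φ, hφ⟩ := exists_eq_comp_rangeRestrict (d n) x.1
        (ker_le_ker_of_cocycleToHomology_eq_zero n x hx)
      obtain ⟨ψ, hψ⟩ := (exists_extend_of_extConnecting_eq_zero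
        (Submodule.injective_subtype (LinearMap.range (d n))) (LinearMap.exact_subtype_mkQ _)
        (Submodule.mkQ_surjective _) φ).1 (Subsingleton.elim _ _)
      refine ⟨ψ, ?_⟩
      rw [← hψ] at hφ
      exact hφ
    · rintro ⟨ψ, hψ⟩
      refine Submodule.linearMap_qext _ (LinearMap.ext fun z => ?_)
      change x.1 z.1 = 0
      rw [show x.1 = _ from hψ.symm]
      change ψ (d n z.1) = 0
      rw [show d n z.1 = 0 from z.2, map_zero]

include hd in
/-- The comparison of the cohomology of `Hom(K, Y)` with the `Ext` modules of the homology of a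
complex `K` of projective modules, when the `Ext` modules of the homology are concentrated in a
single degree `g` below degree `r`. -/
theorem nonempty_cohomology_equiv_ext_homology {g r : ℕ}
    (hlow : ∀ i, ∀ j < g, Subsingleton (ExtMod A (HomologyOf d i) Y j))
    (hhigh : ∀ i < r, ∀ j, g < j → Subsingleton (ExtMod A (HomologyOf d i) Y j)) :
    Nonempty (CohomologyOf d Y (r + g) ≃ₗ[A] ExtMod A (HomologyOf d r) Y g) := by
  cases g with
  | zero =>
    cases r with
    | zero =>
      obtain ⟨e⟩ := nonempty_cohomology_zero_equiv (d := d) (Y := Y)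
      exact ⟨e.trans (extZeroEquiv _ _).symm⟩
    | succ r =>
      obtain ⟨e⟩ := nonempty_cohomology_equiv_homology_dual (Y := Y) hd r
        (subsingleton_ext_coker hd hhigh r.lt_succ_self (by omega))
        (subsingleton_ext_coker hd hhigh r.lt_succ_self (by omega))
      exact ⟨e.trans (extZeroEquiv _ _).symm⟩
  | succ g =>
    obtain ⟨e₁⟩ := nonempty_cohomology_equiv_extOne_coker (Y := Y) hd (r + g)
      (have := hlow (r + g + 1) 0 g.succ_pos
       (extZeroEquiv (HomologyOf d (r + g + 1)) Y).symm.injective.subsingleton)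
    obtain ⟨e₂⟩ := nonempty_extOne_coker_equiv (Y := Y) hd hlow g r g.lt_succ_self
    obtain ⟨e₃⟩ := nonempty_extCoker_equiv_extHomology (Y := Y) hd hhigh
    exact ⟨e₁.trans (e₂.trans e₃)⟩

end CohomologyComparison

end LinearComplex

/-! ### Exterior algebra identities and rigidity of Koszul cohomology. -/

section Koszul

variable {A : Type u} [CommRing A] {M : Type u} [AddCommGroup M] [Module A M]

theorem ι_mul_mem_exteriorPower (e : M) (n : ℕ) (x : ExteriorAlgebra A M) (hx : x ∈ ⋀[A]^n M) :
    LinearMap.mulLeft A (ExteriorAlgebra.ι A e) x ∈ ⋀[A]^(n + 1) M := by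
  rw [ExteriorAlgebra.exteriorPower, pow_succ']
  exact Submodule.mul_mem_mul ⟨e, rfl⟩ hx

/-- Exterior multiplication by `e` on the left. -/
def wedge (e : M) (n : ℕ) : ⋀[A]^n M →ₗ[A] ⋀[A]^(n + 1) M :=
  (LinearMap.mulLeft A (ExteriorAlgebra.ι A e)).restrict (ι_mul_mem_exteriorPower e n)

/-- Contraction is an antiderivation, so wedging with e is a null-homotopy of multiplication by
f(e). It both makes I kill homology and splits off coordinates. -/
theorem koszulD_wedge_add (f : Module.Dual A M) (e : M) (n : ℕ) (x : ⋀[A]^(n + 1) M) :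
    koszulD f (n + 1) (wedge e (n + 1) x) + wedge e n (koszulD f n x) = f e • x := by
  refine Subtype.ext ?_
  have := CliffordAlgebra.contractLeft_ι_mul (Q := (0 : QuadraticForm A M)) f e x.1
  exact (congrArg (· + _) this).trans (sub_add_cancel _ _)

theorem koszulD_wedge_zero (f : Module.Dual A M) (e : M) (x : ⋀[A]^0 M) :
    koszulD f 0 (wedge e 0 x) = f e • x := by
  refine Subtype.ext ?_
  have := CliffordAlgebra.contractLeft_ι_mul (Q := (0 : QuadraticForm A M)) f e x.1
  refine this.trans ?_
  obtain ⟨a, ha⟩ := Submodule.mem_one.1 (show x.1 ∈ (1 : Submodule A (ExteriorAlgebra A M)) by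
    simpa [ExteriorAlgebra.exteriorPower] using x.2)
  have h0 : CliffordAlgebra.contractLeft (Q := (0 : QuadraticForm A M)) f x.1 = 0 := by
    rw [← ha]
    exact CliffordAlgebra.contractLeft_algebraMap _ _ _
  rw [h0, mul_zero, sub_zero]
  rfl

theorem koszulD_anticomm (f f' : Module.Dual A M) (n : ℕ) (x : ⋀[A]^(n + 2) M) :
    koszulD f n (koszulD f' (n + 1) x) = -koszulD f' n (koszulD f (n + 1) x) :=
  Subtype.ext (CliffordAlgebra.contractLeft_comm _ _ x.1)

theorem contractLeft_ιMulti_eq_zero (f : Module.Dual A M) {n : ℕ} (v : Fin n → M)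
    (hv : ∀ i, f (v i) = 0) :
    CliffordAlgebra.contractLeft (Q := (0 : QuadraticForm A M)) f
      (ExteriorAlgebra.ιMulti A n v) = 0 := by
  induction n with
  | zero =>
    rw [ExteriorAlgebra.ιMulti_zero_apply]
    exact CliffordAlgebra.contractLeft_one _ _
  | succ n ih =>
    rw [ExteriorAlgebra.ιMulti_succ_apply]
    refine (CliffordAlgebra.contractLeft_ι_mul (Q := (0 : QuadraticForm A M)) f _ _).trans ?_
    rw [hv, zero_smul, ih (Matrix.vecTail v) fun i => hv i.succ, mul_zero, sub_zero]

theorem ιMulti_eq_koszulD_wedge (f : Module.Dual A M) (e : M) (he : f e = 1) {n : ℕ}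
    (v : Fin n → M) (hv : ∀ i, f (v i) = 0) :
    koszulD f n (wedge e n (exteriorPower.ιMulti A n v)) = exteriorPower.ιMulti A n v := by
  refine Subtype.ext ?_
  refine (CliffordAlgebra.contractLeft_ι_mul (Q := (0 : QuadraticForm A M)) f e _).trans ?_
  refine (congrArg _ (congrArg _ (contractLeft_ιMulti_eq_zero f v hv))).trans ?_
  rw [he, mul_zero, sub_zero, one_smul]
  rfl

variable {m : ℕ}

/-- A basis monomial of degree n < m misses some index j, hence is the contraction of its wedge with
e_j by the j-th coordinate. -/
theorem dual_exteriorPower_eq_zero {n : ℕ} (hn : n < m) (φ : Module.Dual A (⋀[A]^n (Fin m → A)))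
    (hφ : ∀ j, φ ∘ₗ koszulD (LinearMap.proj j) n = 0) : φ = 0 := by
  have hs := exteriorPower.ιMulti_span_of_span A n _ (Pi.basisFun A (Fin m)).span_eq
  refine LinearMap.ext_on hs ?_
  rintro _ ⟨v, hv, rfl⟩
  choose t ht using fun i => hv (Set.mem_range_self i)
  obtain ⟨j, hj⟩ : ∃ j, ∀ i, t i ≠ j := by
    by_contra! h
    have := Fintype.card_le_of_surjective t h
    simp only [Fintype.card_fin] at this
    omega
  rw [← ιMulti_eq_koszulD_wedge (LinearMap.proj j) (Pi.single j 1) (by simp) v fun i => by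
    rw [← ht i]
    simp [(hj i).symm]]
  exact LinearMap.congr_fun (hφ j) _

/-- The functionals on the exterior power that vanish on the images of the contractions with the
first `k` coordinates. -/
def partialDual (A : Type u) [CommRing A] (m k n : ℕ) :
    Submodule A (Module.Dual A (⋀[A]^n (Fin m → A))) where
  carrier := {φ | ∀ j : Fin m, (j : ℕ) < k → φ ∘ₗ koszulD (LinearMap.proj j) n = 0}
  add_mem' h h' j hj := by rw [LinearMap.add_comp, h j hj, h' j hj, add_zero]
  zero_mem' _ _ := LinearMap.zero_comp _
  smul_mem' a φ h j hj := by rw [LinearMap.smul_comp, h j hj, smul_zero]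

/-- Seen as exterior forms, the members P_k of `partialDual A m k` are the multiples of e_0* ∧ ... ∧
e_{k-1}*, a shifted Koszul cochain complex on the remaining u_j. For k = m nothing is left below
degree m. -/
theorem partialDual_eq_bot {n : ℕ} (hn : n < m) : partialDual A m m n = ⊥ :=
  eq_bot_iff.2 fun φ hφ => dual_exteriorPower_eq_zero hn φ fun j => hφ j j.2

theorem partialDual_succ_le (k n : ℕ) : partialDual A m (k + 1) n ≤ partialDual A m k n :=
  fun _ h j hj => h j (by omega)

theorem mem_partialDual_succ {k n : ℕ} (hk : k < m) {φ : Module.Dual A (⋀[A]^n (Fin m → A))}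
    (h : φ ∈ partialDual A m k n) (h' : φ ∘ₗ koszulD (LinearMap.proj ⟨k, hk⟩) n = 0) :
    φ ∈ partialDual A m (k + 1) n := fun j hj => by
  obtain hj | hj := Nat.lt_succ_iff_lt_or_eq.1 hj
  · exact h j hj
  · rw [show j = ⟨k, hk⟩ from Fin.ext hj, h']

theorem comp_koszulD_comp_koszulD (f f' : Module.Dual A M) (n : ℕ)
    (φ : Module.Dual A (⋀[A]^n M)) :
    (φ ∘ₗ koszulD f n) ∘ₗ koszulD f' (n + 1) = -((φ ∘ₗ koszulD f' n) ∘ₗ koszulD f (n + 1)) := by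
  refine LinearMap.ext fun x => ?_
  simp only [LinearMap.comp_apply, LinearMap.neg_apply, koszulD_anticomm f f', map_neg]

theorem comp_koszulD_mem_partialDual (f : Module.Dual A (Fin m → A)) {k n : ℕ}
    {φ : Module.Dual A (⋀[A]^n (Fin m → A))} (h : φ ∈ partialDual A m k n) :
    φ ∘ₗ koszulD f n ∈ partialDual A m k (n + 1) := fun j hj => by
  rw [comp_koszulD_comp_koszulD, h j hj, LinearMap.zero_comp, neg_zero]

theorem comp_koszulD_proj_mem_partialDual_succ {k n : ℕ} (hk : k < m)
    {φ : Module.Dual A (⋀[A]^n (Fin m → A))} (h : φ ∈ partialDual A m k n) :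
    φ ∘ₗ koszulD (LinearMap.proj ⟨k, hk⟩) n ∈ partialDual A m (k + 1) (n + 1) := by
  refine mem_partialDual_succ hk (comp_koszulD_mem_partialDual _ h) ?_
  rw [LinearMap.comp_assoc, koszulD_comp_koszulD, LinearMap.comp_zero]

theorem comp_wedge_comp_koszulD_add (f : Module.Dual A M) (e : M) (n : ℕ)
    (φ : Module.Dual A (⋀[A]^(n + 1) M)) :
    (φ ∘ₗ wedge e n) ∘ₗ koszulD f n + (φ ∘ₗ koszulD f (n + 1)) ∘ₗ wedge e (n + 1) = f e • φ := by
  refine LinearMap.ext fun x => ?_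
  simp only [LinearMap.add_apply, LinearMap.comp_apply, LinearMap.smul_apply]
  rw [add_comm, ← map_add, koszulD_wedge_add, map_smul]

theorem comp_koszulD_comp_wedge_zero (f : Module.Dual A M) (e : M)
    (φ : Module.Dual A (⋀[A]^0 M)) : (φ ∘ₗ koszulD f 0) ∘ₗ wedge e 0 = f e • φ := by
  refine LinearMap.ext fun x => ?_
  simp only [LinearMap.comp_apply, LinearMap.smul_apply]
  rw [koszulD_wedge_zero, map_smul]

theorem comp_wedge_mem_partialDual {k n : ℕ} (hk : k < m)
    {φ : Module.Dual A (⋀[A]^(n + 1) (Fin m → A))} (h : φ ∈ partialDual A m k (n + 1)) :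
    φ ∘ₗ wedge (Pi.single ⟨k, hk⟩ 1) n ∈ partialDual A m k n := fun j hj => by
  have := comp_wedge_comp_koszulD_add (LinearMap.proj j : Module.Dual A (Fin m → A))
    (Pi.single ⟨k, hk⟩ 1) n φ
  rw [h j hj, LinearMap.zero_comp, add_zero] at this
  rw [this, LinearMap.proj_apply, Pi.single_eq_of_ne, zero_smul]
  rintro rfl
  exact lt_irrefl _ hj

variable (u : Fin m → A)

/-- The coboundaries of the complex of the modules `partialDual A m k n`. -/
def partialCoboundaries (k : ℕ) : ∀ n, Submodule A (Module.Dual A (⋀[A]^n (Fin m → A)))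
  | 0 => ⊥
  | n + 1 => (partialDual A m k n).map
      (LinearMap.lcomp A A (koszulD (Fintype.linearCombination A u) n))

/-- Exactness of the complex of the modules `partialDual A m k n` in degree `n`. -/
def PartialExactAt (k n : ℕ) : Prop :=
  ∀ φ ∈ partialDual A m k n, φ ∘ₗ koszulD (Fintype.linearCombination A u) n = 0 →
    φ ∈ partialCoboundaries u k n

variable {u}

theorem PartialExactAt.exists_eq {k n : ℕ} (h : PartialExactAt u k (n + 1))
    {φ : Module.Dual A (⋀[A]^(n + 1) (Fin m → A))} (hφ : φ ∈ partialDual A m k (n + 1))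
    (hφ' : φ ∘ₗ koszulD (Fintype.linearCombination A u) (n + 1) = 0) :
    ∃ ψ ∈ partialDual A m k n, ψ ∘ₗ koszulD (Fintype.linearCombination A u) n = φ :=
  h φ hφ hφ'

theorem linearCombination_single_one (k : Fin m) :
    Fintype.linearCombination A u (Pi.single k 1) = u k := by
  rw [Fintype.linearCombination_apply_single, one_smul]

/-- Contraction by the k-th coordinate gives 0 → P_{k+1}^n → P_k^n → P_{k+1}^{n+1} → 0, with
connecting map ±u_k. If H^{n+1}(P_k) = 0, then u_k is onto on H^{n+1}(P_{k+1}), which vanishes by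
Nakayama. -/
theorem PartialExactAt.partial_succ [IsLocalRing A] [IsNoetherianRing A]
    (hu : ∀ i, u i ∈ IsLocalRing.maximalIdeal A) {k n : ℕ} (hk : k < m)
    (h : PartialExactAt u k (n + 1)) : PartialExactAt u (k + 1) (n + 1) := by
  let δ (n : ℕ) := koszulD (Fintype.linearCombination A u) n
  let ε (n : ℕ) := koszulD (LinearMap.proj ⟨k, hk⟩ : Module.Dual A (Fin m → A)) n
  let b (n : ℕ) := wedge (A := A) (Pi.single ⟨k, hk⟩ (1 : A) : Fin m → A) n
  let Z := partialDual A m (k + 1) (n + 1) ⊓ LinearMap.ker (LinearMap.lcomp A A (δ (n + 1)))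
  suffices hZ : Z ≤ partialCoboundaries u (k + 1) (n + 1) from fun φ hφ hφ' => hZ ⟨hφ, hφ'⟩
  refine Submodule.le_of_le_smul_of_le_jacobson_bot (I := Ideal.span {u ⟨k, hk⟩})
    (IsNoetherian.noetherian _) ?_ ?_
  · rw [IsLocalRing.jacobson_eq_maximalIdeal _ bot_ne_top, Ideal.span_singleton_le_iff_mem]
    exact hu _
  rintro z ⟨hz, hz'⟩
  obtain ⟨w, hw, rfl⟩ := h.exists_eq (partialDual_succ_le _ _ hz) hz'
  have hy := comp_koszulD_proj_mem_partialDual_succ hk hw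
  -- Here y measures the failure of w to lie in P_{k+1}. Subtracting y ∘ b repairs it and changes
  -- the coboundary by u_k y, with y again a cocycle.
  set y := w ∘ₗ ε n with hy_def
  have hδy : y ∘ₗ δ (n + 1) = 0 := by
    rw [hy_def, comp_koszulD_comp_koszulD, hz ⟨k, hk⟩ k.lt_succ_self, neg_zero]
  have hby : y ∘ₗ b n ∈ partialDual A m k n :=
    comp_wedge_mem_partialDual hk (partialDual_succ_le _ _ hy)
  have hyε : y ∘ₗ ε (n + 1) = 0 := hy ⟨k, hk⟩ k.lt_succ_self
  have hw' : w - y ∘ₗ b n ∈ partialDual A m (k + 1) n := by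
    refine mem_partialDual_succ hk (Submodule.sub_mem _ hw hby) ?_
    have := comp_wedge_comp_koszulD_add (LinearMap.proj ⟨k, hk⟩ : Module.Dual A (Fin m → A))
      (Pi.single ⟨k, hk⟩ 1) n y
    rw [show y ∘ₗ koszulD (LinearMap.proj ⟨k, hk⟩) (n + 1) = 0 from hyε, LinearMap.zero_comp,
      add_zero, LinearMap.proj_apply, Pi.single_eq_same, one_smul] at this
    rw [LinearMap.sub_comp, this, sub_eq_zero]
  have huy : (y ∘ₗ b n) ∘ₗ δ n = u ⟨k, hk⟩ • y := by
    have := comp_wedge_comp_koszulD_add (Fintype.linearCombination A u) (Pi.single ⟨k, hk⟩ 1) n y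
    rwa [show y ∘ₗ koszulD (Fintype.linearCombination A u) (n + 1) = 0 from hδy,
      LinearMap.zero_comp, add_zero, linearCombination_single_one] at this
  refine Submodule.mem_sup.2 ⟨(w - y ∘ₗ b n) ∘ₗ δ n, ⟨_, hw', rfl⟩, u ⟨k, hk⟩ • y,
    Submodule.smul_mem_smul (Ideal.mem_span_singleton_self _) ⟨hy, hδy⟩, ?_⟩
  rw [← huy, LinearMap.sub_comp, sub_add_cancel]

/-- In the same long exact sequence H^n(P_k) lies between H^n(P_{k+1}) and H^{n+1}(P_{k+1}). -/
theorem PartialExactAt.of_partial_succ {k n : ℕ} (hk : k < m)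
    (h : PartialExactAt u (k + 1) (n + 1)) (h' : PartialExactAt u (k + 1) n) :
    PartialExactAt u k n := by
  intro z hz hz'
  have haz := comp_koszulD_proj_mem_partialDual_succ hk hz
  obtain ⟨w, hw, hwz⟩ := h.exists_eq haz (by
    rw [comp_koszulD_comp_koszulD, hz', LinearMap.zero_comp, neg_zero])
  have hwε := hw ⟨k, hk⟩ k.lt_succ_self
  have hproj : (LinearMap.proj ⟨k, hk⟩ : Module.Dual A (Fin m → A)) (Pi.single ⟨k, hk⟩ 1) = 1 := by
    rw [LinearMap.proj_apply, Pi.single_eq_same]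
  cases n with
  | zero =>
    -- In degree zero, contraction by a coordinate is injective on functionals, so w = 0 and then z
    -- = 0.
    have hw0 := comp_koszulD_comp_wedge_zero (LinearMap.proj ⟨k, hk⟩ : Module.Dual A (Fin m → A))
      (Pi.single ⟨k, hk⟩ 1) w
    have hz0 := comp_koszulD_comp_wedge_zero (LinearMap.proj ⟨k, hk⟩ : Module.Dual A (Fin m → A))
      (Pi.single ⟨k, hk⟩ 1) z
    rw [hwε, LinearMap.zero_comp, hproj, one_smul] at hw0
    rw [← hwz, ← hw0, LinearMap.zero_comp, LinearMap.zero_comp, hproj, one_smul] at hz0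
    exact hz0.symm
  | succ n =>
    have hbw : w ∘ₗ wedge (Pi.single ⟨k, hk⟩ 1) n ∈ partialDual A m k n :=
      comp_wedge_mem_partialDual hk (partialDual_succ_le _ _ hw)
    -- v lifts w along contraction, so adding its coboundary moves z into P_{k+1}.
    set v := w ∘ₗ wedge (Pi.single ⟨k, hk⟩ 1) n with hv
    have hvε : v ∘ₗ koszulD (LinearMap.proj ⟨k, hk⟩) n = w := by
      have := comp_wedge_comp_koszulD_add (LinearMap.proj ⟨k, hk⟩ : Module.Dual A (Fin m → A))
        (Pi.single ⟨k, hk⟩ 1) n w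
      rwa [hwε, LinearMap.zero_comp, add_zero, hproj, one_smul] at this
    have hz₁ : z + v ∘ₗ koszulD (Fintype.linearCombination A u) n ∈
        partialDual A m (k + 1) (n + 1) := by
      refine mem_partialDual_succ hk
        (Submodule.add_mem _ hz (comp_koszulD_mem_partialDual _ hbw)) ?_
      rw [LinearMap.add_comp, comp_koszulD_comp_koszulD, hvε, hwz, add_neg_cancel]
    obtain ⟨w', hw', hww'⟩ := h'.exists_eq hz₁ (by
      rw [LinearMap.add_comp, hz', zero_add, LinearMap.comp_assoc, koszulD_comp_koszulD,
        LinearMap.comp_zero])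
    refine ⟨w' - v, Submodule.sub_mem _ (partialDual_succ_le _ _ hw') hbw, ?_⟩
    rw [LinearMap.lcomp_apply', LinearMap.sub_comp, hww', add_sub_cancel_right]

/-- Descending induction on k from m, where P_m^n = 0 as n < m. -/
theorem PartialExactAt.of_succ [IsLocalRing A] [IsNoetherianRing A]
    (hu : ∀ i, u i ∈ IsLocalRing.maximalIdeal A) {k n : ℕ} (hk : k ≤ m) (hn : n + 1 ≤ m)
    (h : PartialExactAt u k (n + 1)) : PartialExactAt u k n := by
  induction hk using Nat.decreasingInduction with
  | self =>
    intro φ hφ _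
    rw [partialDual_eq_bot (by omega), Submodule.mem_bot] at hφ
    rw [hφ]
    exact Submodule.zero_mem _
  | of_succ k hk ih => exact (h.partial_succ hu hk).of_partial_succ hk (ih (h.partial_succ hu hk))

/-- Koszul homology, computed from the exterior powers. -/
abbrev KoszulHomologyOf (u : Fin m → A) (n : ℕ) : Type u :=
  HomologyOf (K := fun n => ⋀[A]^n (Fin m → A)) (koszulD (Fintype.linearCombination A u)) n

/-- Koszul cohomology, computed from the exterior powers. -/
abbrev KoszulCohomologyOf (u : Fin m → A) (n : ℕ) : Type u :=
  CohomologyOf (K := fun n => ⋀[A]^n (Fin m → A)) (koszulD (Fintype.linearCombination A u)) A n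

theorem partialExactAt_zero_iff (n : ℕ) : PartialExactAt u 0 n ↔
    Subsingleton (KoszulCohomologyOf u n) := by
  have htop (k : ℕ) : partialDual A m 0 k = ⊤ := eq_top_iff.2 fun φ _ j hj => by omega
  have hb : partialCoboundaries u 0 n =
      coboundariesOf (K := fun n => ⋀[A]^n (Fin m → A)) (koszulD (Fintype.linearCombination A u)) A n := by
    cases n with
    | zero => rfl
    | succ n =>
      rw [partialCoboundaries, htop, Submodule.map_top]
      rfl
  rw [show Subsingleton (KoszulCohomologyOf u n) ↔ _ from Submodule.Quotient.subsingleton_iff,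
    eq_top_iff, PartialExactAt, htop, hb]
  exact ⟨fun h x _ => h x.1 trivial x.2, fun h φ _ hφ => h (x := ⟨φ, hφ⟩) trivial⟩

/-- Rigidity of Koszul cohomology over a Noetherian local ring. -/
theorem subsingleton_koszulCohomologyOf_of_le [IsLocalRing A] [IsNoetherianRing A]
    (hu : ∀ i, u i ∈ IsLocalRing.maximalIdeal A) {n n' : ℕ} (hnn' : n ≤ n') (hn : n' ≤ m)
    (h : Subsingleton (KoszulCohomologyOf u n')) :
    Subsingleton (KoszulCohomologyOf u n) := by
  induction hnn' using Nat.decreasingInduction with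
  | self => exact h
  | of_succ k hk ih =>
    rw [← partialExactAt_zero_iff] at ih ⊢
    exact ih.of_succ hu (Nat.zero_le _) (by omega)

end Koszul

/-! ### Categorical Koszul (co)homology as explicit subquotients. -/

section HomologyIso

variable {A : Type u} [CommRing A]

theorem nonempty_homology_equiv (S : ShortComplex (ModuleCat.{u} A)) {X : Type u} [AddCommGroup X]
    [Module A X] (e : S.X₂ ≃ₗ[A] X) (p q : Submodule A X) (hp : ∀ x, e x ∈ p ↔ S.g.hom x = 0)
    (hq : ∀ x, e x ∈ q ↔ ∃ y, S.f.hom y = x) :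
    Nonempty (S.homology ≃ₗ[A] p ⧸ q.submoduleOf p) := by
  let f : LinearMap.ker S.g.hom →ₗ[A] p :=
    (e.toLinearMap ∘ₗ (LinearMap.ker S.g.hom).subtype).codRestrict p fun x => (hp x.1).2 x.2
  obtain ⟨e'⟩ := nonempty_quotient_equiv_of_ker_eq ((q.submoduleOf p).mkQ ∘ₗ f)
    ((Submodule.mkQ_surjective _).comp fun y => ⟨⟨e.symm y.1, by
      rw [LinearMap.mem_ker, ← hp, e.apply_symm_apply]; exact y.2⟩,
      Subtype.ext (e.apply_symm_apply _)⟩) (LinearMap.range S.moduleCatToCycles) fun x => by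
    rw [LinearMap.comp_apply, Submodule.mkQ_apply, Submodule.Quotient.mk_eq_zero]
    refine (hq x.1).trans ?_
    exact ⟨fun ⟨y, hy⟩ => ⟨y, Subtype.ext hy⟩, fun ⟨y, hy⟩ => ⟨y, congrArg Subtype.val hy⟩⟩
  exact ⟨S.moduleCatHomologyIso.toLinearEquiv.trans e'⟩

variable {m : ℕ} (u : Fin m → A)

theorem koszulComplex_d (n : ℕ) : (koszulComplex u).d (n + 1) n =
    ModuleCat.ofHom (koszulD (Fintype.linearCombination A u) n) :=
  ChainComplex.of_d (fun n => ModuleCat.of A (⋀[A]^n (Fin m → A)))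
    (fun n => ModuleCat.ofHom (koszulD (Fintype.linearCombination A u) n)) n

theorem koszulComplex_d_apply (n : ℕ) (x : ⋀[A]^(n + 1) (Fin m → A)) :
    ((koszulComplex u).d (n + 1) n).hom x = koszulD (Fintype.linearCombination A u) n x := by
  rw [koszulComplex_d]
  rfl

theorem nonempty_koszulHomology_equiv (n : ℕ) :
    Nonempty (koszulHomology u n ≃ₗ[A] KoszulHomologyOf u n) := by
  cases n with
  | zero =>
    -- The index following 0 is 0 itself; the outgoing differential from 0 to 0 is zero.
    obtain ⟨e⟩ := nonempty_homology_equiv ((koszulComplex u).sc' 1 0 0)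
      (X := ⋀[A]^0 (Fin m → A)) (LinearEquiv.refl A (⋀[A]^0 (Fin m → A)))
      (⊤ : Submodule A (⋀[A]^0 (Fin m → A)))
      (LinearMap.range (koszulD (Fintype.linearCombination A u) 0))
      (fun x => ⟨fun _ => LinearMap.congr_fun (congrArg ModuleCat.Hom.hom
        ((koszulComplex u).shape 0 0 (by simp))) x, fun _ => trivial⟩)
      (fun x => ⟨fun ⟨y, hy⟩ => ⟨y, (koszulComplex_d_apply u 0 y).trans hy⟩,
        fun ⟨y, hy⟩ => ⟨y, (koszulComplex_d_apply u 0 y).symm.trans hy⟩⟩)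
    exact ⟨((koszulComplex u).homologyIsoSc' 1 0 0 (by simp) (by simp)).toLinearEquiv.trans e⟩
  | succ n =>
    obtain ⟨e⟩ := nonempty_homology_equiv ((koszulComplex u).sc' (n + 2) (n + 1) n)
      (X := ⋀[A]^(n + 1) (Fin m → A)) (LinearEquiv.refl A (⋀[A]^(n + 1) (Fin m → A)))
      (LinearMap.ker (koszulD (Fintype.linearCombination A u) n))
      (LinearMap.range (koszulD (Fintype.linearCombination A u) (n + 1)))
      (fun x => ⟨fun h => (koszulComplex_d_apply u n x).trans h,
        fun h => (koszulComplex_d_apply u n x).symm.trans h⟩)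
      (fun x => ⟨fun ⟨y, hy⟩ => ⟨y, (koszulComplex_d_apply u (n + 1) y).trans hy⟩,
        fun ⟨y, hy⟩ => ⟨y, (koszulComplex_d_apply u (n + 1) y).symm.trans hy⟩⟩)
    exact ⟨((koszulComplex u).homologyIsoSc' (n + 2) (n + 1) n (by simp)
      (by simp)).toLinearEquiv.trans e⟩

theorem koszulCochainComplex_d (n : ℕ)
    (x : (koszulComplex u).X n ⟶ ModuleCat.of A A) :
    ((koszulCochainComplex u).d n (n + 1)).hom x =
      ModuleCat.ofHom (koszulD (Fintype.linearCombination A u) n) ≫ x := by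
  rw [← koszulComplex_d]
  rfl

/-- The modules of the Koszul cochain complex are the duals of the exterior powers. -/
def koszulCochainEquiv (n : ℕ) :
    (koszulCochainComplex u).X n ≃ₗ[A] (⋀[A]^n (Fin m → A) →ₗ[A] A) :=
  (ModuleCat.homLinearEquiv (S := A) :
    (ModuleCat.of A (⋀[A]^n (Fin m → A)) ⟶ ModuleCat.of A A) ≃ₗ[A] _)

theorem koszulCochainEquiv_d (n : ℕ) (x : (koszulCochainComplex u).X n) :
    koszulCochainEquiv u (n + 1) (((koszulCochainComplex u).d n (n + 1)).hom x) =
      koszulCochainEquiv u n x ∘ₗ koszulD (Fintype.linearCombination A u) n :=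
  congrArg ModuleCat.Hom.hom (koszulCochainComplex_d u n x)

theorem koszulCochainEquiv_mem_cocycles_iff (n : ℕ) (x : (koszulCochainComplex u).X n) :
    koszulCochainEquiv u n x ∈
        LinearMap.ker (LinearMap.lcomp A A (koszulD (Fintype.linearCombination A u) n)) ↔
      ((koszulCochainComplex u).d n (n + 1)).hom x = 0 := by
  rw [← LinearEquiv.map_eq_zero_iff (koszulCochainEquiv u (n + 1)), koszulCochainEquiv_d]
  rfl

theorem nonempty_koszulCohomology_equiv (n : ℕ) :
    Nonempty (koszulCohomology u n ≃ₗ[A] KoszulCohomologyOf u n) := by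
  cases n with
  | zero =>
    obtain ⟨e⟩ := nonempty_homology_equiv ((koszulCochainComplex u).sc' 0 0 1)
      (koszulCochainEquiv u 0) _ (⊥ : Submodule A (⋀[A]^0 (Fin m → A) →ₗ[A] A))
      (koszulCochainEquiv_mem_cocycles_iff u 0)
      (fun x => by
        have h : (koszulCochainComplex u).d 0 0 = 0 :=
          (koszulCochainComplex u).shape 0 0 (by simp)
        refine (Submodule.mem_bot A).trans
          ((LinearEquiv.map_eq_zero_iff (koszulCochainEquiv u 0)).trans ?_)
        exact ⟨fun hx => ⟨0, (map_zero _).trans hx.symm⟩, fun ⟨y, hy⟩ =>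
          hy.symm.trans (LinearMap.congr_fun (congrArg ModuleCat.Hom.hom h) y)⟩)
    exact ⟨((koszulCochainComplex u).homologyIsoSc' 0 0 1 (by simp) (by simp)).toLinearEquiv.trans
      e⟩
  | succ n =>
    obtain ⟨e⟩ := nonempty_homology_equiv ((koszulCochainComplex u).sc' n (n + 1) (n + 2))
      (koszulCochainEquiv u (n + 1)) _
      (LinearMap.range (LinearMap.lcomp A A (koszulD (Fintype.linearCombination A u) n)))
      (koszulCochainEquiv_mem_cocycles_iff u (n + 1))
      (fun x => by
        constructor
        · rintro ⟨y, hy⟩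
          refine ⟨(koszulCochainEquiv u n).symm y, (koszulCochainEquiv u (n + 1)).injective ?_⟩
          refine (koszulCochainEquiv_d u n _).trans ?_
          rw [LinearEquiv.apply_symm_apply]
          exact hy
        · rintro ⟨y, rfl⟩
          exact ⟨koszulCochainEquiv u n y, (koszulCochainEquiv_d u n y).symm⟩)
    exact ⟨((koszulCochainComplex u).homologyIsoSc' n (n + 1) (n + 2) (by simp)
      (by simp)).toLinearEquiv.trans e⟩

end HomologyIso

/-! ### Regular sequences, Ext and grade. -/

section RegularSequences

open Abelian RingTheory.Sequence

variable {A : Type u} [CommRing A] {N Y : Type u} [AddCommGroup N] [Module A N] [AddCommGroup Y]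
  [Module A Y]

/-- The first element a acts as zero on Ext(N, Y), so Ext^{j+1}(N, Y) is a quotient of Ext^j(N,
Y/aY); induct on the sequence. -/
theorem subsingleton_ext_of_isWeaklyRegular (rs : List A) (hrs : IsWeaklyRegular Y rs)
    (hN : ∀ r ∈ rs, ∀ x : N, r • x = 0) (j : ℕ) (hj : j < rs.length) :
    Subsingleton (ExtMod A N Y j) := by
  induction rs generalizing Y j with
  | nil => exact absurd hj (Nat.not_lt_zero _)
  | cons a rs ih =>
    rw [isWeaklyRegular_cons_iff] at hrs
    have haN := hN a List.mem_cons_self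
    cases j with
    | zero =>
      have := hrs.1.linearMap_subsingleton_of_mem_annihilator (N := N)
        (Module.mem_annihilator.2 haN)
      exact (extZeroEquiv N Y).injective.subsingleton
    | succ j =>
      have := ih hrs.2 (fun r hr => hN r (List.mem_cons_of_mem _ hr)) j (by simpa using hj)
      refine subsingleton_of_forall_eq 0 fun x => ?_
      obtain ⟨y, rfl⟩ := Ext.covariant_sequence_exact₁ (ModuleCat.of A N)
        (IsSMulRegular.smulShortComplex_shortExact (M := ModuleCat.of A Y) hrs.1) x
        ((Ext.smul_eq_comp_mk₀ (R := A) (X := ModuleCat.of A N) (Y := ModuleCat.of A Y)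
          x a).symm.trans (smul_ext_eq_zero_of_smul_eq_zero haN _ x)) rfl
      rw [show y = 0 from Subsingleton.elim (α := ExtMod A N (QuotSMulTop a Y) j) _ _,
        Ext.zero_comp]
      rfl

/-- Each regular element costs one degree: Ext^j(N, Y/aY) lies between Ext^j(N, Y) and Ext^{j+1}(N,
Y). -/
theorem subsingleton_ext_quotient_of_isWeaklyRegular (rs : List A) (hrs : IsWeaklyRegular Y rs)
    (n : ℕ) (h : ∀ j < n, Subsingleton (ExtMod A N Y j)) (j : ℕ) (hj : j + rs.length < n) :
    Subsingleton (ExtMod A N (Y ⧸ (Ideal.ofList rs • ⊤ : Submodule A Y)) j) := by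
  induction rs generalizing Y n with
  | nil =>
    have := h j hj
    have e : (Y ⧸ (Ideal.ofList [] • ⊤ : Submodule A Y)) ≃ₗ[A] Y :=
      Submodule.quotEquivOfEqBot _ ((congrArg (· • (⊤ : Submodule A Y)) Ideal.ofList_nil).trans (Submodule.bot_smul _))
    refine subsingleton_of_forall_eq 0 fun x => ?_
    rw [← Ext.comp_mk₀_id x, show 𝟙 (ModuleCat.of A (Y ⧸ (Ideal.ofList [] • ⊤ : Submodule A Y)))
      = ModuleCat.ofHom e.toLinearMap ≫ ModuleCat.ofHom e.symm.toLinearMap by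
        rw [← ModuleCat.ofHom_comp, LinearEquiv.symm_comp]; rfl, ← Ext.mk₀_comp_mk₀,
      ← Ext.comp_assoc_of_third_deg_zero,
      show x.comp (Ext.mk₀ (ModuleCat.ofHom e.toLinearMap)) (add_zero j) = 0 from
        Subsingleton.elim (α := ExtMod A N Y j) _ _, Ext.zero_comp]
  | cons a rs ih =>
    rw [isWeaklyRegular_cons_iff] at hrs
    rw [List.length_cons] at hj
    have := ih hrs.2 (n - 1) (fun i hi => by
      have := h i (by omega)
      have := h (i + 1) (by omega)
      exact subsingleton_ext_quotSMulTop hrs.1 i) (by omega)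
    have e := Submodule.quotOfListConsSMulTopEquivQuotSMulTopInner Y a rs
    refine subsingleton_of_forall_eq 0 fun x => ?_
    rw [← Ext.comp_mk₀_id x, show 𝟙 (ModuleCat.of A
        (Y ⧸ (Ideal.ofList (a :: rs) • ⊤ : Submodule A Y)))
      = ModuleCat.ofHom e.toLinearMap ≫ ModuleCat.ofHom e.symm.toLinearMap by
        rw [← ModuleCat.ofHom_comp, LinearEquiv.symm_comp]; rfl, ← Ext.mk₀_comp_mk₀,
      ← Ext.comp_assoc_of_third_deg_zero,
      show x.comp (Ext.mk₀ (ModuleCat.ofHom e.toLinearMap)) (add_zero j) = 0 from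
        Subsingleton.elim (α := ExtMod A N (QuotSMulTop a Y ⧸
          (Ideal.ofList rs • ⊤ : Submodule A (QuotSMulTop a Y))) j) _ _, Ext.zero_comp]

theorem nonempty_ext_equiv_hom_quotient (rs : List A) (hrs : IsWeaklyRegular Y rs)
    (hN : ∀ r ∈ rs, ∀ x : N, r • x = 0) :
    Nonempty (ExtMod A N Y rs.length ≃ₗ[A]
      (N →ₗ[A] Y ⧸ (Ideal.ofList rs • ⊤ : Submodule A Y))) := by
  induction rs generalizing Y with
  | nil =>
    have e : (Y ⧸ (Ideal.ofList [] • ⊤ : Submodule A Y)) ≃ₗ[A] Y :=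
      Submodule.quotEquivOfEqBot _ ((congrArg (· • (⊤ : Submodule A Y)) Ideal.ofList_nil).trans (Submodule.bot_smul _))
    exact ⟨(extZeroEquiv N Y).trans (e.symm.congrRight)⟩
  | cons a rs ih =>
    have := subsingleton_ext_of_isWeaklyRegular (a :: rs) hrs hN rs.length (by simp)
    rw [isWeaklyRegular_cons_iff] at hrs
    obtain ⟨e⟩ := ih hrs.2 (fun r hr => hN r (List.mem_cons_of_mem _ hr))
    exact ⟨(extQuotSMulTopEquiv hrs.1 (hN a List.mem_cons_self) rs.length).symm.trans (e.trans
      (Submodule.quotOfListConsSMulTopEquivQuotSMulTopInner Y a rs).symm.congrRight)⟩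

theorem isWeaklyRegular_of_flat {rs : List A} (h : IsWeaklyRegular A rs) (P : Type u)
    [AddCommGroup P] [Module A P] [Module.Flat A P] : IsWeaklyRegular P rs :=
  (LinearEquiv.isWeaklyRegular_congr (TensorProduct.rid A P) rs).1 h.isWeaklyRegular_lTensor

theorem le_grade_iff {I : Ideal A} {M : Type*} [AddCommGroup M] [Module A M] (n : ℕ) :
    (n : ℕ∞) ≤ grade I M ↔
      ∃ rs : List A, rs.length = n ∧ (∀ r ∈ rs, r ∈ I) ∧ IsWeaklyRegular M rs := by
  constructor
  · intro h
    by_contra! hc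
    -- A longer sequence could be truncated to length n. The part n ≠ 0 makes the natural
    -- subtraction genuine.
    have hlt : grade I M ≤ (n - 1 : ℕ) ∧ n ≠ 0 := by
      refine ⟨iSup_le fun rs => iSup_le fun hI => iSup_le fun hrs => ?_, ?_⟩
      · by_contra! hlt
        have hlen : n ≤ rs.length := by
          have := ENat.natCast_lt_natCast.1 hlt
          omega
        refine hc (rs.take n) (by simp [hlen]) (fun r hr => hI r (List.mem_of_mem_take hr)) ?_
        rw [← List.take_append_drop n rs, isWeaklyRegular_append_iff] at hrs
        exact hrs.1
      · rintro rfl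
        exact hc [] rfl (by simp) (IsWeaklyRegular.nil A M)
    have := ENat.natCast_le_natCast.1 (h.trans hlt.1)
    omega
  · rintro ⟨rs, rfl, hI, hrs⟩
    exact le_iSup_of_le rs (le_iSup_of_le hI (le_iSup_of_le hrs le_rfl))

/-- The sequence 1, ..., 1 is weakly regular at any length. Hence an ideal of finite grade is
proper. -/
theorem grade_top (M : Type*) [AddCommGroup M] [Module A M] : grade (⊤ : Ideal A) M = ⊤ := by
  refine ENat.eq_top_iff_forall_ge.2 fun n => (le_grade_iff n).2
    ⟨List.replicate n 1, by simp, by simp, ?_⟩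
  have (M : Type _) [AddCommGroup M] [Module A M] : IsWeaklyRegular M (List.replicate n (1 : A)) := by
    induction n generalizing M with
    | zero => exact IsWeaklyRegular.nil A M
    | succ n ih =>
      rw [List.replicate_succ, isWeaklyRegular_cons_iff]
      exact ⟨IsSMulRegular.one M, ih _⟩
  exact this M

end RegularSequences

/-! ### Annihilator and size of Koszul homology. -/

section KoszulAnnihilator

open RingTheory.Sequence

variable {A : Type u} [CommRing A] {m : ℕ} (u : Fin m → A)

theorem smul_mem_range_koszulD (n : ℕ) (i : Fin m) (x : ⋀[A]^n (Fin m → A))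
    (hx : x ∈ cyclesOf (K := fun n => ⋀[A]^n (Fin m → A))
      (koszulD (Fintype.linearCombination A u)) n) :
    u i • x ∈ LinearMap.range (koszulD (Fintype.linearCombination A u) n) := by
  cases n with
  | zero =>
    refine ⟨wedge (Pi.single i 1) 0 x, ?_⟩
    rw [koszulD_wedge_zero, linearCombination_single_one]
  | succ n =>
    refine ⟨wedge (Pi.single i 1) (n + 1) x, ?_⟩
    have := koszulD_wedge_add (Fintype.linearCombination A u) (Pi.single i 1) n x
    rwa [show koszulD (Fintype.linearCombination A u) n x = 0 from hx, map_zero, add_zero,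
      linearCombination_single_one] at this

theorem smul_koszulHomologyOf_eq_zero (n : ℕ) {a : A} (ha : a ∈ Ideal.span (Set.range u))
    (x : KoszulHomologyOf u n) : a • x = 0 := by
  suffices Ideal.span (Set.range u) ≤ Module.annihilator A (KoszulHomologyOf u n) from
    Module.mem_annihilator.1 (this ha) x
  rw [Ideal.span_le]
  rintro _ ⟨i, rfl⟩
  refine Module.mem_annihilator.2 fun x => ?_
  obtain ⟨x, rfl⟩ := Submodule.mkQ_surjective _ x
  rw [← map_smul]
  exact (Submodule.Quotient.mk_eq_zero _).2 (smul_mem_range_koszulD u n i x.1 x.2)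

/-- If a kills the class of 1, then a · 1 is the boundary of some degree-one v, that is, a = ∑ v_i
u_i. -/
theorem annihilator_koszulHomologyOf_zero :
    Module.annihilator A (KoszulHomologyOf u 0) = Ideal.span (Set.range u) := by
  refine le_antisymm (fun a ha => ?_) fun a ha => Module.mem_annihilator.2 fun x =>
    smul_koszulHomologyOf_eq_zero u 0 ha x
  let one : ⋀[A]^0 (Fin m → A) := exteriorPower.ιMulti A 0 ![]
  have h := Module.mem_annihilator.1 ha
    (Submodule.mkQ _ (⟨one, trivial⟩ : cyclesOf (K := fun n => ⋀[A]^n (Fin m → A))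
      (koszulD (Fintype.linearCombination A u)) 0))
  rw [← map_smul] at h
  obtain ⟨y, hy⟩ := (Submodule.Quotient.mk_eq_zero _).1 h
  obtain ⟨v, hv⟩ := (exteriorPower.oneEquiv A (Fin m → A)).symm.surjective y
  have hy' := congrArg Subtype.val hy
  have hyv : y.1 = ExteriorAlgebra.ι A v := by
    rw [← hv, exteriorPower.oneEquiv_symm_apply]
    simp
  have h1 : CliffordAlgebra.contractLeft (Q := (0 : QuadraticForm A (Fin m → A)))
      (Fintype.linearCombination A u) y.1 = algebraMap A _ (Fintype.linearCombination A u v) := by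
    rw [hyv]
    exact CliffordAlgebra.contractLeft_ι _ _ _
  have h2 : algebraMap A (ExteriorAlgebra A (Fin m → A)) (Fintype.linearCombination A u v) =
      algebraMap A _ a := by
    refine (h1.symm.trans hy').trans ?_
    change a • (ExteriorAlgebra.ιMulti A 0 ![]) = _
    rw [ExteriorAlgebra.ιMulti_zero_apply, Algebra.algebraMap_eq_smul_one]
  rw [ExteriorAlgebra.algebraMap_inj] at h2
  rw [← h2, Fintype.linearCombination_apply]
  exact Submodule.sum_mem _ fun i _ =>
    Ideal.mul_mem_left _ _ (Ideal.subset_span (Set.mem_range_self i))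

instance finite_koszulHomologyOf [IsNoetherianRing A] (n : ℕ) :
    Module.Finite A (KoszulHomologyOf u n) :=
  have : IsNoetherian A (⋀[A]^n (Fin m → A)) := isNoetherian_of_isNoetherianRing_of_finite A _
  inferInstance

theorem support_koszulHomologyOf_zero [IsNoetherianRing A] :
    Module.support A (KoszulHomologyOf u 0) =
      PrimeSpectrum.zeroLocus (Ideal.span (Set.range u)) := by
  rw [Module.support_eq_zeroLocus, annihilator_koszulHomologyOf_zero]

theorem subsingleton_exteriorPower {n : ℕ} (hn : m < n) :
    Subsingleton (⋀[A]^n (Fin m → A)) := by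
  have hs := exteriorPower.ιMulti_family_span_of_span A (n := n) (Pi.basisFun A (Fin m)).span_eq
  have : IsEmpty (Set.powersetCard (Fin m) n) := ⟨fun s => by
    have h1 := s.2
    have h2 := Finset.card_le_univ s.1
    simp only [Set.powersetCard.mem_iff, Fintype.card_fin] at h1 h2
    omega⟩
  rw [Set.range_eq_empty, Submodule.span_empty] at hs
  exact (Submodule.subsingleton_iff A).1 (subsingleton_of_bot_eq_top hs)

end KoszulAnnihilator

/-! ### The acyclicity lemma. -/

section AcyclicityLemma

open Abelian RingTheory.Sequence

variable {A : Type u} [CommRing A]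

theorem subsingleton_ext_of_subsingleton_right {N Y : Type u} [AddCommGroup N] [Module A N]
    [AddCommGroup Y] [Module A Y] [Subsingleton Y] (n : ℕ) : Subsingleton (ExtMod A N Y n) := by
  refine subsingleton_of_forall_eq 0 fun x => ?_
  rw [← Ext.comp_mk₀_id x, show 𝟙 (ModuleCat.of A Y) = 0 from ?_, Ext.mk₀_zero, Ext.comp_zero]
  ext y
  exact Subsingleton.elim _ _

variable {K : ℕ → Type u} [∀ n, AddCommGroup (K n)] [∀ n, Module A (K n)]
  {d : ∀ n, K (n + 1) →ₗ[A] K n} (hd : ∀ n, d n ∘ₗ d (n + 1) = 0)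

include hd

theorem range_le_cyclesOf (i : ℕ) : LinearMap.range (d i) ≤ cyclesOf d i := by
  cases i with
  | zero => exact le_top
  | succ i =>
    rintro _ ⟨x, rfl⟩
    exact LinearMap.congr_fun (hd i) x

theorem ker_eq_range_of_subsingleton_homologyOf {i : ℕ} (h : Subsingleton (HomologyOf d (i + 1))) :
    LinearMap.ker (d i) = LinearMap.range (d (i + 1)) :=
  le_antisymm (fun x hx => (Submodule.Quotient.mk_eq_zero _).1
    (h.elim (Submodule.mkQ _ (⟨x, hx⟩ : cyclesOf d (i + 1))) 0)) (range_le_cyclesOf hd (i + 1))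

variable {J : Ideal A} (hJ : ∀ n, ∀ a ∈ J, ∀ x : HomologyOf d n, a • x = 0)

include hJ

/-- Hom(A/J, -) kills the cycles, a submodule of K_i, and Ext^1(A/J, B_i) = 0, so Hom(A/J, H_i) = 0.
Since J kills H_i, each x in H_i is the image of 1 under such a map. -/
theorem subsingleton_homologyOf_of_subsingleton_ext {i : ℕ}
    (h0 : Subsingleton (ExtMod A (A ⧸ J) (K i) 0))
    (h1 : Subsingleton (ExtMod A (A ⧸ J) (LinearMap.range (d i)) 1)) :
    Subsingleton (HomologyOf d i) := by
  have hZ : Subsingleton (ExtMod A (A ⧸ J) (cyclesOf d i) 0) := by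
    have hK : Subsingleton ((A ⧸ J) →ₗ[A] K i) :=
      (extZeroEquiv (A ⧸ J) (K i)).symm.injective.subsingleton
    have : Subsingleton ((A ⧸ J) →ₗ[A] cyclesOf d i) := ⟨fun a b => by
      have h := hK.elim ((cyclesOf d i).subtype ∘ₗ a) ((cyclesOf d i).subtype ∘ₗ b)
      exact LinearMap.ext fun x => Subtype.ext (LinearMap.congr_fun h x)⟩
    exact (extZeroEquiv (A ⧸ J) (cyclesOf d i)).injective.subsingleton
  have : Subsingleton (ExtMod A (A ⧸ J) (HomologyOf d i) 0) :=
    subsingleton_ext_covariant_right (f := Submodule.inclusion (range_le_cyclesOf hd i))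
      (g := ((LinearMap.range (d i)).submoduleOf (cyclesOf d i)).mkQ)
      (Submodule.inclusion_injective _)
      (LinearMap.exact_iff.2 ((Submodule.ker_mkQ _).trans (Submodule.range_inclusion _ _ _).symm))
      (Submodule.mkQ_surjective _) 0
  have : Subsingleton ((A ⧸ J) →ₗ[A] HomologyOf d i) :=
    (extZeroEquiv (A ⧸ J) (HomologyOf d i)).symm.injective.subsingleton
  refine subsingleton_of_forall_eq 0 fun x => ?_
  have := LinearMap.congr_fun (this.elim
    (Submodule.liftQ J (LinearMap.toSpanSingleton A _ x) fun a ha => hJ i a ha x) 0)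
    (Submodule.Quotient.mk 1)
  exact (one_smul A x).symm.trans this

variable {m g : ℕ} (hK : ∀ n, m < n → Subsingleton (K n))
  (hg : ∀ n, ∀ j < g, Subsingleton (ExtMod A (A ⧸ J) (K n) j))

include hK hg

/-- Descending induction on i, starting from B_i = 0 for i ≥ m. Vanishing of H_{i+1} makes 0 →
B_{i+1} → K_{i+1} → B_i → 0 exact, and each step loses one Ext degree. -/
theorem subsingleton_ext_range_of_bounded {i j : ℕ} (hij : j + m < g + i + 1) :
    Subsingleton (ExtMod A (A ⧸ J) (LinearMap.range (d i)) j) := by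
  induction hk : m - i generalizing i j with
  | zero =>
    have := hK (i + 1) (by omega)
    have : Subsingleton (LinearMap.range (d i)) := (d i).surjective_rangeRestrict.subsingleton
    exact subsingleton_ext_of_subsingleton_right j
  | succ k ih =>
    have ih (j : ℕ) (hj : j + m < g + (i + 1) + 1) := ih hj (by omega)
    have hH := subsingleton_homologyOf_of_subsingleton_ext hd hJ (i := i + 1)
      (hg (i + 1) 0 (by omega)) (ih 1 (by omega))
    have := hg (i + 1) j (by omega)
    have := ih (j + 1) (by omega)
    refine subsingleton_ext_covariant_right
      (f := (LinearMap.range (d (i + 1))).subtype) (g := (d i).rangeRestrict)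
      (Submodule.injective_subtype _) ?_ (LinearMap.surjective_rangeRestrict _) j
    rw [LinearMap.exact_iff, LinearMap.ker_rangeRestrict, Submodule.range_subtype,
      ker_eq_range_of_subsingleton_homologyOf hd hH]

/-- A form of the acyclicity lemma of Peskine and Szpiro. -/
theorem subsingleton_homologyOf_of_bounded {i : ℕ} (hi : m < g + i) :
    Subsingleton (HomologyOf d i) := by
  refine subsingleton_homologyOf_of_subsingleton_ext hd hJ ?_
    (subsingleton_ext_range_of_bounded hd hJ hK hg (by omega))
  by_cases him : m < i
  · have := hK i him
    exact subsingleton_ext_of_subsingleton_right 0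
  · exact hg i 0 (by omega)

end AcyclicityLemma

/-! ### Vanishing of high Koszul homology. -/

section KoszulVanishing

open RingTheory.Sequence

variable {A : Type u} [CommRing A] {m : ℕ} {u : Fin m → A}

theorem subsingleton_koszulHomologyOf_of_isWeaklyRegular {rs : List A}
    (hrs : IsWeaklyRegular A rs) (hI : ∀ r ∈ rs, r ∈ Ideal.span (Set.range u)) {i : ℕ}
    (hi : m < rs.length + i) : Subsingleton (KoszulHomologyOf u i) := by
  refine subsingleton_homologyOf_of_bounded (koszulD_comp_koszulD _)
    (fun n a ha x => smul_koszulHomologyOf_eq_zero u n ha x)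
    (fun n hn => subsingleton_exteriorPower hn) (fun n j hj => ?_) hi
  refine subsingleton_ext_of_isWeaklyRegular rs (isWeaklyRegular_of_flat hrs _) ?_ j hj
  intro r hr x
  obtain ⟨x, rfl⟩ := Submodule.mkQ_surjective _ x
  rw [← map_smul]
  exact (Submodule.Quotient.mk_eq_zero _).2 (Ideal.mul_mem_right _ _ (hI r hr))

end KoszulVanishing

/-! ### Nakayama arguments for Ext over a local ring. -/

section LocalNakayama

open Abelian RingTheory.Sequence IsLocalRing
open scoped Pointwise

variable {A : Type u} [CommRing A] [IsLocalRing A] [IsNoetherianRing A]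

omit [IsNoetherianRing A] in
theorem subsingleton_of_smul_surjective {X : Type*} [AddCommGroup X] [Module A X]
    [Module.Finite A X] {a : A} (ha : a ∈ maximalIdeal A)
    (h : Function.Surjective fun x : X => a • x) : Subsingleton X := by
  refine (Submodule.subsingleton_iff A).1 (subsingleton_of_bot_eq_top ?_)
  refine (Submodule.eq_bot_of_le_smul_of_le_jacobson_bot (maximalIdeal A) ⊤ Module.Finite.fg_top
    (fun x _ => ?_) (maximalIdeal_le_jacobson _)).symm
  obtain ⟨y, rfl⟩ := h x
  exact Submodule.smul_mem_smul ha trivial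

variable {X Y : Type u} [AddCommGroup X] [Module A X] [AddCommGroup Y] [Module A Y]

/-- Vanishing of Ext^{j+1}(X/aX, Y) makes a surjective on the finite module Ext^j(X, Y). -/
theorem subsingleton_ext_of_quotSMulTop [Module.Finite A X] [Module.Finite A Y] {a : A}
    (ha : a ∈ maximalIdeal A) (haX : IsSMulRegular X a) (j : ℕ)
    (h : Subsingleton (ExtMod A (QuotSMulTop a X) Y (j + 1))) :
    Subsingleton (ExtMod A X Y j) := by
  refine subsingleton_of_smul_surjective ha fun x => ?_
  obtain ⟨y, hy⟩ := extPrecomp_left_surjective (f := LinearMap.lsmul A X a)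
    (g := (a • (⊤ : Submodule A X)).mkQ) haX (LinearMap.exact_lsmul_mkQ_smul_top X a)
    (Submodule.mkQ_surjective _) j x
  exact ⟨y, (LinearMap.congr_fun (extPrecomp_smul_id a j) y).symm.trans hy⟩

omit [IsLocalRing A] [IsNoetherianRing A] in
theorem subsingleton_ext_quotSMulTop_left {a : A} (haX : IsSMulRegular X a) (j : ℕ)
    (h : Subsingleton (ExtMod A X Y j)) (h' : Subsingleton (ExtMod A X Y (j + 1))) :
    Subsingleton (ExtMod A (QuotSMulTop a X) Y (j + 1)) :=
  subsingleton_ext_right (f := LinearMap.lsmul A X a) (g := (a • (⊤ : Submodule A X)).mkQ) haX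
    (LinearMap.exact_lsmul_mkQ_smul_top X a) (Submodule.mkQ_surjective _) j

theorem subsingleton_ext_of_quotient_ofList [Module.Finite A X] [Module.Finite A Y] {rs : List A}
    (hm : ∀ r ∈ rs, r ∈ maximalIdeal A) (hrs : IsWeaklyRegular X rs) (j : ℕ)
    (h : Subsingleton (ExtMod A (X ⧸ (Ideal.ofList rs • ⊤ : Submodule A X)) Y (j + rs.length))) :
    Subsingleton (ExtMod A X Y j) := by
  induction rs generalizing X j with
  | nil =>
    have e : (X ⧸ (Ideal.ofList [] • ⊤ : Submodule A X)) ≃ₗ[A] X :=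
      Submodule.quotEquivOfEqBot _
        ((congrArg (· • (⊤ : Submodule A X)) Ideal.ofList_nil).trans (Submodule.bot_smul _))
    exact (extCongr (Y := Y) e j).injective.subsingleton
  | cons a rs ih =>
    rw [isWeaklyRegular_cons_iff] at hrs
    refine subsingleton_ext_of_quotSMulTop (hm a List.mem_cons_self) hrs.1 j
      (ih (fun r hr => hm r (List.mem_cons_of_mem _ hr)) hrs.2 (j + 1) ?_)
    rw [show j + 1 + rs.length = j + (a :: rs).length by simp; omega]
    exact (extCongr (Y := Y) (Submodule.quotOfListConsSMulTopEquivQuotSMulTopInner X a rs)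
      _).injective.subsingleton

omit [IsLocalRing A] [IsNoetherianRing A] in
theorem subsingleton_ext_quotient_ofList_left {rs : List A} (hrs : IsWeaklyRegular X rs) {d : ℕ}
    (h : ∀ j, d < j → Subsingleton (ExtMod A X Y j)) (j : ℕ) (hj : d + rs.length < j) :
    Subsingleton (ExtMod A (X ⧸ (Ideal.ofList rs • ⊤ : Submodule A X)) Y j) := by
  induction rs generalizing X d j with
  | nil =>
    have := h j hj
    have e : (X ⧸ (Ideal.ofList [] • ⊤ : Submodule A X)) ≃ₗ[A] X :=
      Submodule.quotEquivOfEqBot _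
        ((congrArg (· • (⊤ : Submodule A X)) Ideal.ofList_nil).trans (Submodule.bot_smul _))
    exact (extCongr (Y := Y) e j).symm.injective.subsingleton
  | cons a rs ih =>
    rw [isWeaklyRegular_cons_iff] at hrs
    have := ih (d := d + 1) hrs.2 (fun j hj => by
      obtain ⟨j, rfl⟩ := Nat.exists_eq_succ_of_ne_zero (Nat.ne_zero_of_lt hj)
      exact subsingleton_ext_quotSMulTop_left hrs.1 j (h _ (by omega)) (h _ (by omega))) j
      (by simp at hj; omega)
    exact (extCongr (Y := Y) (Submodule.quotOfListConsSMulTopEquivQuotSMulTopInner X a rs)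
      _).symm.injective.subsingleton

omit [IsLocalRing A] [IsNoetherianRing A] in
theorem isSMulRegular_quotient_prime {p : Ideal A} [p.IsPrime] {a : A} (ha : a ∉ p) :
    IsSMulRegular (A ⧸ p) a := by
  have h : Ideal.Quotient.mk p a ≠ 0 := fun h => ha (Ideal.Quotient.eq_zero_iff_mem.1 h)
  intro x y hxy
  simp only [Algebra.smul_def] at hxy
  exact mul_left_cancel₀ h hxy

omit [IsLocalRing A] [IsNoetherianRing A] in
theorem smul_quotient_eq_zero {I : Ideal A} {a : A} (ha : a ∈ I) (x : A ⧸ I) : a • x = 0 :=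
  Module.mem_annihilator.1 (by rwa [Ideal.annihilator_quotient]) x

omit [IsNoetherianRing A] in
theorem exists_mem_maximalIdeal_notMem {p : Ideal A} [p.IsPrime] (hp : p ≠ maximalIdeal A) :
    ∃ a ∈ maximalIdeal A, a ∉ p := by
  by_contra! h
  exact hp (le_antisymm (le_maximalIdeal_of_isPrime p) h)

theorem subsingleton_ext_quotient_prime [Module.Finite A Y] {p : Ideal A} [p.IsPrime]
    (hp : p ≠ maximalIdeal A) (j : ℕ)
    (h : ∀ (N : Type u) [AddCommGroup N] [Module A N] [Module.Finite A N],
      Subsingleton (ExtMod A N Y (j + 1))) :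
    Subsingleton (ExtMod A (A ⧸ p) Y j) := by
  obtain ⟨a, ham, hap⟩ := exists_mem_maximalIdeal_notMem hp
  exact subsingleton_ext_of_quotSMulTop ham (isSMulRegular_quotient_prime hap) j (h _)

end LocalNakayama

/-! ### Ischebeck's theorem. -/

section Ischebeck

open Abelian RingTheory.Sequence IsLocalRing
open scoped Pointwise

variable {A : Type u} [CommRing A] [IsLocalRing A] [IsNoetherianRing A]
  {Y : Type u} [AddCommGroup Y] [Module A Y] [Module.Finite A Y]

omit [IsLocalRing A] [Module.Finite A Y] in
-- Prime filtration: submodules and quotients do not increase dimension, and Ext vanishing passes to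
-- extensions.
theorem subsingleton_ext_of_forall_prime (e : WithBot ℕ∞) (j : ℕ)
    (h : ∀ p : Ideal A, p.IsPrime → Module.supportDim A (A ⧸ p) ≤ e →
      Subsingleton (ExtMod A (A ⧸ p) Y j))
    (N : Type u) [AddCommGroup N] [Module A N] [Module.Finite A N]
    (hN : Module.supportDim A N ≤ e) : Subsingleton (ExtMod A N Y j) := by
  revert hN
  refine IsNoetherianRing.induction_on_isQuotientEquivQuotientPrime A ‹Module.Finite A N›
    (motive := fun N _ _ _ => Module.supportDim A N ≤ e → Subsingleton (ExtMod A N Y j)) ?_ ?_ ?_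
  · intro N _ _ _ _ _
    exact subsingleton_ext_of_subsingleton j
  · intro N _ _ _ p f hN
    have := h p.1 p.2 (by rwa [← Module.supportDim_eq_of_equiv f])
    exact (extCongr (Y := Y) f j).symm.injective.subsingleton
  · intro N₁ _ _ _ N₂ _ _ _ N₃ _ _ _ f g hf hg hfg h₁ h₃ hN
    have := h₁ ((Module.supportDim_le_of_injective f hf).trans hN)
    have := h₃ ((Module.supportDim_le_of_surjective g hg).trans hN)
    exact subsingleton_ext_middle hf hfg hg j

/-- Ischebeck's vanishing theorem. -/
theorem subsingleton_ext_of_supportDim_le {rs : List A} (hm : ∀ r ∈ rs, r ∈ maximalIdeal A)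
    (hrs : IsWeaklyRegular Y rs) (e j : ℕ) (hj : j + e < rs.length)
    (N : Type u) [AddCommGroup N] [Module A N] [Module.Finite A N]
    (hN : Module.supportDim A N ≤ e) : Subsingleton (ExtMod A N Y j) := by
  induction e generalizing j N with
  | zero =>
    refine subsingleton_ext_of_forall_prime _ j (fun p hp hN => ?_) N hN
    by_cases h : p = maximalIdeal A
    · exact subsingleton_ext_of_isWeaklyRegular rs hrs
        (fun r hr => smul_quotient_eq_zero (h ▸ hm r hr)) j (by omega)
    · obtain ⟨a, ham, hap⟩ := exists_mem_maximalIdeal_notMem h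
      have hreg := isSMulRegular_quotient_prime hap
      refine subsingleton_ext_of_quotSMulTop ham hreg j ?_
      -- Killing the regular element a drops the dimension by one, so from at most 0 it becomes `⊥`.
      have : Subsingleton (QuotSMulTop a (A ⧸ p)) := by
        rw [← Module.supportDim_quotSMulTop_succ_eq_supportDim hreg ham] at hN
        rw [← Module.supportDim_eq_bot_iff_subsingleton A]
        generalize Module.supportDim A (QuotSMulTop a (A ⧸ p)) = x at hN
        induction x with
        | bot => rfl
        | coe x =>
          exfalso
          have : x + 1 ≤ 0 := by exact_mod_cast hN
          simp at this
      exact subsingleton_ext_of_subsingleton _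
  | succ e ih =>
    refine subsingleton_ext_of_forall_prime _ j (fun p hp hN => ?_) N hN
    by_cases h : p = maximalIdeal A
    · exact subsingleton_ext_of_isWeaklyRegular rs hrs
        (fun r hr => smul_quotient_eq_zero (h ▸ hm r hr)) j (by omega)
    · obtain ⟨a, ham, hap⟩ := exists_mem_maximalIdeal_notMem h
      have hreg := isSMulRegular_quotient_prime hap
      -- Cutting by a trades one dimension for one Ext degree, preserving the bound on j + e.
      refine subsingleton_ext_of_quotSMulTop ham hreg j (ih (j + 1) (by omega) _ ?_)
      rw [← Module.supportDim_quotSMulTop_succ_eq_supportDim hreg ham] at hN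
      generalize Module.supportDim A (QuotSMulTop a (A ⧸ p)) = x at hN
      induction x with
      | bot => exact bot_le
      | coe x =>
        have : x + 1 ≤ (e : ℕ∞) + 1 := by exact_mod_cast hN
        have : x ≤ e := (ENat.add_le_add_iff_right ENat.one_ne_top).1 this
        exact_mod_cast this

end Ischebeck

/-! ### Finite injective dimension: its value and the Cohen–Macaulay property. -/

section FiniteInjectiveDimension

open Abelian RingTheory.Sequence IsLocalRing
open scoped Pointwise

variable {A : Type u} [CommRing A] [IsLocalRing A] [IsNoetherianRing A]

/-- There is a maximal regular sequence in the maximal ideal. -/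
theorem exists_maximal_isWeaklyRegular : ∃ rs : List A, (∀ r ∈ rs, r ∈ maximalIdeal A) ∧
    IsWeaklyRegular A rs ∧ ∀ rs' : List A, (∀ r ∈ rs', r ∈ maximalIdeal A) →
      IsWeaklyRegular A rs' → rs'.length ≤ rs.length := by
  classical
  let P (n : ℕ) : Prop := ∃ rs : List A, rs.length = n ∧ (∀ r ∈ rs, r ∈ maximalIdeal A) ∧
    IsWeaklyRegular A rs
  obtain ⟨D, hD⟩ : ∃ D : ℕ, ringKrullDim A ≤ D := by
    have h1 := ringKrullDim_lt_top (R := A)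
    have h2 := ringKrullDim_nonneg_of_nontrivial (R := A)
    generalize ringKrullDim A = x at h1 h2
    induction x with
    | bot => simp at h2
    | coe x =>
      induction x with
      | top => simp at h1
      | coe x => exact ⟨x, le_rfl⟩
  -- Each regular element lowers the finite Krull dimension by one, so lengths are bounded and a
  -- maximum exists.
  have hbound (rs : List A) (hm : ∀ r ∈ rs, r ∈ maximalIdeal A) (hrs : IsWeaklyRegular A rs) :
      rs.length ≤ D := by
    have hreg := (isRegular_iff_isWeaklyRegular_of_subset_maximalIdeal hm).2 hrs
    have h := ringKrullDim_add_length_eq_ringKrullDim_of_isRegular rs hreg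
    have hle : Ideal.ofList rs ≤ maximalIdeal A := Ideal.span_le.2 hm
    have : Nontrivial (A ⧸ Ideal.ofList rs) :=
      Ideal.Quotient.nontrivial_iff.2 fun h => (maximalIdeal.isMaximal A).ne_top (top_le_iff.1 (h ▸ hle))
    have h0 := ringKrullDim_nonneg_of_nontrivial (R := A ⧸ Ideal.ofList rs)
    have : (rs.length : WithBot ℕ∞) ≤ D := by
      refine le_trans ?_ hD
      rw [← h]
      exact le_add_of_nonneg_left h0
    exact_mod_cast this
  have h0 : P 0 := ⟨[], rfl, by simp, IsWeaklyRegular.nil A A⟩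
  obtain ⟨rs, hlen, hm, hrs⟩ := Nat.findGreatest_spec (P := P) (Nat.zero_le D) h0
  refine ⟨rs, hm, hrs, fun rs' hm' hrs' => ?_⟩
  rw [hlen]
  exact Nat.le_findGreatest (hbound rs' hm' hrs') ⟨rs', rfl, hm', hrs'⟩

variable {rs : List A} (hm : ∀ r ∈ rs, r ∈ maximalIdeal A) (hrs : IsWeaklyRegular A rs)
  (hmax : ∀ rs' : List A, (∀ r ∈ rs', r ∈ maximalIdeal A) →
    IsWeaklyRegular A rs' → rs'.length ≤ rs.length)

include hm hrs hmax

/-- By maximality no element of the maximal ideal is regular on A/(rs), so there is a nonzero map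
from the residue field; simplicity makes it injective. -/
theorem exists_residueField_injective :
    ∃ f : (A ⧸ maximalIdeal A) →ₗ[A] A ⧸ (Ideal.ofList rs • ⊤ : Submodule A A),
      Function.Injective f := by
  have : ¬ Subsingleton ((A ⧸ maximalIdeal A) →ₗ[A] A ⧸ (Ideal.ofList rs • ⊤ : Submodule A A)) := by
    rw [IsSMulRegular.subsingleton_linearMap_iff]
    rintro ⟨a, ha, hreg⟩
    rw [Ideal.annihilator_quotient] at ha
    have := hmax (rs ++ [a]) (by simpa [or_imp, forall_and] using ⟨hm, ha⟩) (by
      rw [isWeaklyRegular_append_iff]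
      exact ⟨hrs, (isWeaklyRegular_singleton_iff _ _).2 hreg⟩)
    simp at this
  rw [not_subsingleton_iff_nontrivial] at this
  obtain ⟨f, hf⟩ := exists_ne (0 : (A ⧸ maximalIdeal A) →ₗ[A] A ⧸ (Ideal.ofList rs • ⊤ : Submodule A A))
  have : IsSimpleModule A (A ⧸ maximalIdeal A) :=
    isSimpleModule_iff_quot_maximal.2 ⟨_, maximalIdeal.isMaximal A, ⟨LinearEquiv.refl _ _⟩⟩
  exact ⟨f, (LinearMap.injective_or_eq_zero f).resolve_right hf⟩

/-- Embed the residue field in A/(rs), whose Ext into A vanishes above the length of rs; the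
Ext^{j+1} of the cokernel vanishes by assumption. -/
theorem subsingleton_ext_residueField (j : ℕ) (hj : rs.length < j)
    (h : ∀ (N : Type u) [AddCommGroup N] [Module A N] [Module.Finite A N],
      Subsingleton (ExtMod A N A (j + 1))) :
    Subsingleton (ExtMod A (A ⧸ maximalIdeal A) A j) := by
  obtain ⟨f, hf⟩ := exists_residueField_injective hm hrs hmax
  have := subsingleton_ext_quotient_ofList_left (Y := A) (d := 0) hrs (fun j hj => by
    obtain ⟨j, rfl⟩ := Nat.exists_eq_succ_of_ne_zero (Nat.ne_zero_of_lt hj)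
    exact subsingleton_ext_of_projective j) j (by omega)
  have := h (_ ⧸ LinearMap.range f)
  exact subsingleton_ext_left hf (LinearMap.exact_map_mkQ_range f) (Submodule.mkQ_surjective _) j

/-- The injective dimension of a local ring, if it is finite, is its depth. -/
theorem subsingleton_ext_of_length_lt
    (hfin : ∃ n : ℕ, ∀ (N : Type u) [AddCommGroup N] [Module A N], ∀ j, n ≤ j →
      Subsingleton (ExtMod A N A j)) (j : ℕ) (hj : rs.length < j)
    (N : Type u) [AddCommGroup N] [Module A N] [Module.Finite A N] :
    Subsingleton (ExtMod A N A j) := by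
  obtain ⟨n, hn⟩ := hfin
  -- Descending induction on j from the given bound n; a prime filtration reduces to A/p, with the
  -- residue field treated separately.
  induction hk : n - j generalizing j N with
  | zero => exact hn N j (by omega)
  | succ k ih =>
    have ih (N : Type u) [AddCommGroup N] [Module A N] [Module.Finite A N] :=
      ih (j + 1) (by omega) N (by omega)
    refine IsNoetherianRing.induction_on_isQuotientEquivQuotientPrime A ‹Module.Finite A N›
      (motive := fun N _ _ _ => Subsingleton (ExtMod A N A j)) ?_ ?_ ?_
    · intro N _ _ _ _
      exact subsingleton_ext_of_subsingleton j
    · intro N _ _ _ p e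
      have := p.2
      suffices Subsingleton (ExtMod A (A ⧸ p.1) A j) from
        (extCongr (Y := A) e j).symm.injective.subsingleton
      by_cases hp : p.1 = maximalIdeal A
      · rw [hp]
        exact subsingleton_ext_residueField hm hrs hmax j hj ih
      · exact subsingleton_ext_quotient_prime hp j ih
    · intro N₁ _ _ _ N₂ _ _ _ N₃ _ _ _ f g hf hg hfg h₁ h₃
      exact subsingleton_ext_middle hf hfg hg j

/-- Otherwise Ext^i(A/q, A) = 0 for all i up to the length of rs, so q would contain a longer
regular sequence. -/
theorem eq_maximalIdeal_of_ofList_le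
    (hfin : ∃ n : ℕ, ∀ (N : Type u) [AddCommGroup N] [Module A N], ∀ j, n ≤ j →
      Subsingleton (ExtMod A N A j)) (q : Ideal A) [q.IsPrime] (hq : Ideal.ofList rs ≤ q) :
    q = maximalIdeal A := by
  by_contra hne
  have hlt : q • (⊤ : Submodule A A) < ⊤ := by
    rw [smul_eq_mul, Ideal.mul_top]
    exact lt_top_iff_ne_top.2 (Ideal.IsPrime.ne_top ‹_›)
  obtain ⟨rs', hlen, hmem, hreg⟩ := ModuleCat.exists_isRegular_of_exists_subsingleton_ext q
    (rs.length + 1) (ModuleCat.of A A) hlt (ModuleCat.of A (A ⧸ q))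
    (by
      rw [Module.support_eq_zeroLocus]
      exact congrArg (fun I : Ideal A => PrimeSpectrum.zeroLocus (I : Set A)) Ideal.annihilator_quotient)
    (fun i hi => by
      rcases Nat.lt_succ_iff_lt_or_eq.1 hi with hi | rfl
      · refine subsingleton_ext_of_isWeaklyRegular (N := A ⧸ q) (Y := A) rs hrs
          (fun r hr => smul_quotient_eq_zero (hq (Ideal.subset_span hr))) i hi
      · exact subsingleton_ext_quotient_prime (Y := A) hne rs.length fun N =>
          subsingleton_ext_of_length_lt hm hrs hmax hfin _ (Nat.lt_succ_self _) N)
  have := hmax rs' (fun r hr => le_maximalIdeal_of_isPrime q (hmem r hr)) hreg.toIsWeaklyRegular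
  omega

theorem ringKrullDim_eq_length
    (hfin : ∃ n : ℕ, ∀ (N : Type u) [AddCommGroup N] [Module A N], ∀ j, n ≤ j →
      Subsingleton (ExtMod A N A j)) : ringKrullDim A = rs.length := by
  have hreg := (isRegular_iff_isWeaklyRegular_of_subset_maximalIdeal hm).2 hrs
  have hle : Ideal.ofList rs ≤ maximalIdeal A := Ideal.span_le.2 hm
  have : Nontrivial (A ⧸ Ideal.ofList rs) :=
    Ideal.Quotient.nontrivial_iff.2 fun h => (maximalIdeal.isMaximal A).ne_top (top_le_iff.1 (h ▸ hle))
  have : Ring.KrullDimLE 0 (A ⧸ Ideal.ofList rs) := Ring.KrullDimLE.mk₀ fun q hq => by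
    have h1 : Ideal.ofList rs ≤ q.comap (Ideal.Quotient.mk (Ideal.ofList rs)) := fun x hx => by
      rw [Ideal.mem_comap, Ideal.Quotient.eq_zero_iff_mem.2 hx]
      exact q.zero_mem
    have h2 := eq_maximalIdeal_of_ofList_le hm hrs hmax hfin _ h1
    rw [← Ideal.map_comap_of_surjective _ Ideal.Quotient.mk_surjective q, h2]
    refine (Ideal.map_eq_top_or_isMaximal_of_surjective _ Ideal.Quotient.mk_surjective
      (maximalIdeal.isMaximal A)).resolve_left fun h => hq.ne_top ?_
    rw [← Ideal.map_comap_of_surjective _ Ideal.Quotient.mk_surjective q, h2, h]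
  have h0 : ringKrullDim (A ⧸ Ideal.ofList rs) = 0 :=
    le_antisymm (Order.krullDimLE_iff 0 _ |>.1 this) ringKrullDim_nonneg_of_nontrivial
  rw [← ringKrullDim_add_length_eq_ringKrullDim_of_isRegular rs hreg, h0, zero_add]

/-- Since ht P + dim A/P ≤ dim A = depth A, this is Ischebeck's theorem for A/P. -/
theorem subsingleton_ext_quotient_of_lt_height
    (hfin : ∃ n : ℕ, ∀ (N : Type u) [AddCommGroup N] [Module A N], ∀ j, n ≤ j →
      Subsingleton (ExtMod A N A j)) (P : Ideal A) [P.IsPrime] (i : ℕ) (hi : (i : ℕ∞) < P.height) :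
    Subsingleton (ExtMod A (A ⧸ P) A i) := by
  have h1 : ((P.height + Order.coheight (⟨P, ‹_›⟩ : PrimeSpectrum A) : ℕ∞) : WithBot ℕ∞) ≤
      rs.length := by
    rw [← ringKrullDim_eq_length hm hrs hmax hfin, ringKrullDim,
      Order.krullDim_eq_iSup_height_add_coheight_of_nonempty, WithBot.coe_le_coe,
      show P.height = _ from PrimeSpectrum.height_eq_orderHeight ⟨P, ‹_›⟩]
    exact le_iSup (fun p : PrimeSpectrum A => Order.height p + Order.coheight p) ⟨P, ‹_›⟩
  have h2 : Module.supportDim A (A ⧸ P) = Order.coheight (⟨P, ‹_›⟩ : PrimeSpectrum A) := by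
    rw [Module.supportDim_quotient_eq_ringKrullDim, ringKrullDim_quotient,
      Order.coheight_eq_krullDim_Ici]
    rfl
  generalize P.height = h at h1 hi
  generalize Order.coheight (⟨P, ‹_›⟩ : PrimeSpectrum A) = c at h1 h2
  replace h1 : h + c ≤ rs.length := by exact_mod_cast h1
  lift c to ℕ using by rintro rfl; simp at h1
  lift h to ℕ using by rintro rfl; simp at h1
  norm_cast at h1 hi
  exact subsingleton_ext_of_supportDim_le hm hrs c i (by omega) _ h2.le

end FiniteInjectiveDimension

/-! ### Cohen–Macaulay modules have Ext in one degree. -/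

section CohenMacaulay

open Abelian RingTheory.Sequence IsLocalRing

variable {A : Type u} [CommRing A]

theorem grade_congr {I : Ideal A} {M N : Type*} [AddCommGroup M] [Module A M] [AddCommGroup N]
    [Module A N] (e : M ≃ₗ[A] N) : grade I M = grade I N := by
  simp only [grade, e.isWeaklyRegular_congr]

variable [IsLocalRing A]

theorem IsCohenMacaulay.of_equiv {M N : Type*} [AddCommGroup M] [Module A M] [AddCommGroup N]
    [Module A N] (e : M ≃ₗ[A] N) (h : IsCohenMacaulay A M) : IsCohenMacaulay A N := by
  rcases h with h | h
  · exact .inl e.symm.injective.subsingleton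
  · exact .inr (by rw [depth, ← grade_congr e, ← Module.supportDim_eq_of_equiv e, ← h, depth])

variable [IsNoetherianRing A] {rs : List A} (hm : ∀ r ∈ rs, r ∈ maximalIdeal A)
  (hrs : IsWeaklyRegular A rs)
  (hvan : ∀ j, rs.length < j → ∀ (N : Type u) [AddCommGroup N] [Module A N] [Module.Finite A N],
      Subsingleton (ExtMod A N A j))

include hm hrs hvan

theorem IsCohenMacaulay.subsingleton_ext {N : Type u} [AddCommGroup N] [Module A N]
    [Module.Finite A N] (hN : IsCohenMacaulay A N) {g : ℕ} (hg : ¬ Subsingleton (ExtMod A N A g))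
    {j : ℕ} (hj : g < j) : Subsingleton (ExtMod A N A j) := by
  rcases hN with hN | hN
  · exact subsingleton_ext_of_subsingleton j
  -- If depth N = dim N were smaller than d - g, Ischebeck would force Ext^g(N, A) = 0. If the
  -- truncated difference is 0, the bound is trivial.
  · have hdepth : ((rs.length - g : ℕ) : ℕ∞) ≤ depth A N := by
      by_contra! hlt
      obtain ⟨e, he⟩ := Nat.exists_eq_succ_of_ne_zero (n := rs.length - g) (by
        rintro h0
        rw [h0] at hlt
        simp at hlt)
      refine hg (subsingleton_ext_of_supportDim_le hm hrs e g (by omega) N ?_)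
      rw [← hN]
      rw [he] at hlt
      have : depth A N ≤ e := ENat.lt_add_one_iff (ENat.natCast_ne_top e) |>.1 (by exact_mod_cast hlt)
      exact_mod_cast this
    obtain ⟨ys, hlen, hym, hys⟩ := (le_grade_iff _).1 hdepth
    exact subsingleton_ext_of_quotient_ofList hym hys j (hvan _ (by omega) _)

end CohenMacaulay

/-! ### Concentration of Ext of Koszul homology in degree g. -/

section KoszulExt

open Abelian RingTheory.Sequence IsLocalRing

variable {A : Type u} [CommRing A] {m : ℕ} (u : Fin m → A) {xs : List A}
  (hxs : IsWeaklyRegular A xs) (hxI : ∀ x ∈ xs, x ∈ Ideal.span (Set.range u))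

include hxs hxI

theorem subsingleton_ext_koszulHomologyOf (i j : ℕ) (hj : j < xs.length) :
    Subsingleton (ExtMod A (KoszulHomologyOf u i) A j) :=
  subsingleton_ext_of_isWeaklyRegular xs hxs
    (fun x hx => smul_koszulHomologyOf_eq_zero u i (hxI x hx)) j hj

theorem nonempty_koszulCohomologyOf_equiv_ext {r : ℕ}
    (hhigh : ∀ i < r, ∀ j, xs.length < j → Subsingleton (ExtMod A (KoszulHomologyOf u i) A j)) :
    Nonempty (KoszulCohomologyOf u (r + xs.length) ≃ₗ[A]
      ExtMod A (KoszulHomologyOf u r) A xs.length) :=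
  nonempty_cohomology_equiv_ext_homology (koszulD_comp_koszulD _)
    (subsingleton_ext_koszulHomologyOf u hxs hxI) hhigh

variable [IsNoetherianRing A]
  (hgrade : grade (Ideal.span (Set.range u)) A = xs.length)

include hgrade

/-- Were it zero, Ext^i(H_0, A) would vanish for all i ≤ g, and Rees's criterion would give a
regular sequence of length g + 1 in I. -/
theorem not_subsingleton_ext_koszulHomologyOf_zero :
    ¬ Subsingleton (ExtMod A (KoszulHomologyOf u 0) A xs.length) := by
  intro h
  have hlt : Ideal.span (Set.range u) • (⊤ : Submodule A A) < ⊤ := by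
    rw [smul_eq_mul, Ideal.mul_top]
    refine lt_top_iff_ne_top.2 fun h => ?_
    rw [h, grade_top] at hgrade
    exact ENat.top_ne_natCast _ hgrade
  obtain ⟨ys, hlen, hmem, hreg⟩ := ModuleCat.exists_isRegular_of_exists_subsingleton_ext
    (Ideal.span (Set.range u)) (xs.length + 1) (ModuleCat.of A A) hlt
    (ModuleCat.of A (KoszulHomologyOf u 0)) (support_koszulHomologyOf_zero u)
    (fun i hi => by
      rcases Nat.lt_succ_iff_lt_or_eq.1 hi with hi | rfl
      · exact subsingleton_ext_koszulHomologyOf u hxs hxI 0 i hi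
      · exact h)
  have := (le_grade_iff (I := Ideal.span (Set.range u)) (M := A) (xs.length + 1)).2
    ⟨ys, hlen, hmem, hreg.toIsWeaklyRegular⟩
  rw [hgrade] at this
  have : xs.length + 1 ≤ xs.length := by exact_mod_cast this
  omega

variable [IsLocalRing A] {rs : List A} (hm : ∀ r ∈ rs, r ∈ maximalIdeal A)
  (hrs : IsWeaklyRegular A rs)
  (hvan : ∀ j, rs.length < j → ∀ (N : Type u) [AddCommGroup N] [Module A N] [Module.Finite A N],
      Subsingleton (ExtMod A N A j))

include hm hrs hvan

theorem subsingleton_ext_koszulHomologyOf_of_isCohenMacaulay {r : ℕ}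
    (hCM : ∀ i < r, IsCohenMacaulay A (KoszulHomologyOf u i)) (i : ℕ) (hi : i < r) (j : ℕ)
    (hj : xs.length < j) : Subsingleton (ExtMod A (KoszulHomologyOf u i) A j) := by
  induction i using Nat.strong_induction_on generalizing j with
  | _ i ih =>
    by_cases him : m < xs.length + i
    · have := subsingleton_koszulHomologyOf_of_isWeaklyRegular hxs hxI him
      exact subsingleton_ext_of_subsingleton j
    -- The induction hypothesis yields H^{i+g} ≅ Ext^g(H_i, A). If this vanishes, rigidity gives H^g
    -- = 0, contradicting Ext^g(H_0, A) ≠ 0.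
    · refine (hCM i hi).subsingleton_ext hm hrs hvan (g := xs.length) (fun h => ?_) hj
      obtain ⟨e⟩ := nonempty_koszulCohomologyOf_equiv_ext u hxs hxI (r := i)
        (fun k hk j hj => ih k hk (hk.trans hi) j hj)
      obtain ⟨e₀⟩ := nonempty_koszulCohomologyOf_equiv_ext u hxs hxI (r := 0) (by simp)
      have hu (k) : u k ∈ maximalIdeal A := by
        refine le_maximalIdeal (J := Ideal.span (Set.range u)) (fun h => ?_)
          (Ideal.subset_span (Set.mem_range_self k))
        rw [h, grade_top] at hgrade
        exact ENat.top_ne_natCast _ hgrade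
      have := subsingleton_koszulCohomologyOf_of_le hu (n := 0 + xs.length) (n' := i + xs.length)
        (by omega) (by omega) e.injective.subsingleton
      exact not_subsingleton_ext_koszulHomologyOf_zero u hxs hxI hgrade e₀.symm.injective.subsingleton

end KoszulExt

/-! ### Regular sequences of length at most two on Hom. -/

section HomRegular

open RingTheory.Sequence
open scoped Pointwise

variable {A : Type*} [CommRing A] {N B : Type*} [AddCommGroup N] [Module A N] [AddCommGroup B]
  [Module A B]

theorem isSMulRegular_linearMap {a : A} (ha : IsSMulRegular B a) : IsSMulRegular (N →ₗ[A] B) a :=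
  fun _ _ h => LinearMap.ext fun x => ha (LinearMap.congr_fun h x)

/-- If bf = ag, regularity of b on B/aB puts the values of f in aB. As a is regular on B, they can
be divided by a linearly. -/
theorem isSMulRegular_quotSMulTop_linearMap {a b : A} (ha : IsSMulRegular B a)
    (hb : IsSMulRegular (QuotSMulTop a B) b) : IsSMulRegular (QuotSMulTop a (N →ₗ[A] B)) b := by
  refine (isSMulRegular_quotient_iff_mem_of_smul_mem _ _).2 fun f hf => ?_
  obtain ⟨g, -, hg⟩ := (Submodule.mem_smul_pointwise_iff_exists _ _ _).1 hf
  have hmem (x : N) : f x ∈ LinearMap.range (LinearMap.lsmul A B a) := by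
    have := (isSMulRegular_quotient_iff_mem_of_smul_mem _ _).1 hb (f x)
      ((Submodule.mem_smul_pointwise_iff_exists _ _ _).2 ⟨g x, trivial, LinearMap.congr_fun hg x⟩)
    obtain ⟨y, -, hy⟩ := (Submodule.mem_smul_pointwise_iff_exists _ _ _).1 this
    exact ⟨y, hy⟩
  refine (Submodule.mem_smul_pointwise_iff_exists _ _ _).2
    ⟨(LinearEquiv.ofInjective (LinearMap.lsmul A B a) ha).symm.toLinearMap ∘ₗ
      f.codRestrict _ hmem, trivial, LinearMap.ext fun x => ?_⟩
  exact congrArg Subtype.val ((LinearEquiv.ofInjective (LinearMap.lsmul A B a) ha).apply_symm_apply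
    (f.codRestrict _ hmem x))

theorem isWeaklyRegular_linearMap {ys : List A} (hlen : ys.length ≤ 2)
    (h : IsWeaklyRegular B ys) : IsWeaklyRegular (N →ₗ[A] B) ys := by
  match ys, hlen, h with
  | [], _, _ => exact IsWeaklyRegular.nil _ _
  | [a], _, h =>
    rw [isWeaklyRegular_singleton_iff] at h ⊢
    exact isSMulRegular_linearMap h
  | [a, b], _, h =>
    rw [isWeaklyRegular_cons_iff, isWeaklyRegular_singleton_iff] at h ⊢
    exact ⟨isSMulRegular_linearMap h.1, isSMulRegular_quotSMulTop_linearMap h.1 h.2⟩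

end HomRegular

/-! ### Serre's condition S_2. -/

section Serre

open RingTheory.Sequence IsLocalRing

variable {A : Type u} [CommRing A] [IsNoetherianRing A] {I : Ideal A} {xs : List A}
  (hxs : IsWeaklyRegular A xs) (hxI : ∀ x ∈ xs, x ∈ I)

include hxs hxI

/-- Localized at the preimage P of p, the sequence xs cuts the dimension by its length, and A_P/(xs)
maps onto (A/I)_p. -/
theorem height_add_length_le_height_comap (p : Ideal (A ⧸ I)) [p.IsPrime] :
    p.height + xs.length ≤ (p.comap (Ideal.Quotient.mk I)).height := by
  let P := p.comap (Ideal.Quotient.mk I)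
  let S := Localization.AtPrime P
  have hmem : ∀ x ∈ xs, x ∈ P := fun x hx => by
    change Ideal.Quotient.mk I x ∈ p
    rw [Ideal.Quotient.eq_zero_iff_mem.2 (hxI x hx)]
    exact p.zero_mem
  have hreg := IsWeaklyRegular.isRegular_of_isLocalization_of_mem S P hxs hmem
  have hdim := ringKrullDim_add_length_eq_ringKrullDim_of_isRegular _ hreg
  let φ := Localization.localRingHom P p (Ideal.Quotient.mk I) rfl
  have hφ : Function.Surjective φ :=
    RingHom.surjective_localRingHom_of_surjective _ Ideal.Quotient.mk_surjective p
  have hker : ∀ a ∈ Ideal.ofList (xs.map (algebraMap A S)), φ a = 0 := by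
    suffices Ideal.ofList (xs.map (algebraMap A S)) ≤ RingHom.ker φ from this
    refine Ideal.span_le.2 fun y hy => ?_
    obtain ⟨x, hx, rfl⟩ := List.mem_map.1 hy
    change φ (algebraMap A S x) = 0
    rw [Localization.localRingHom_to_map, Ideal.Quotient.eq_zero_iff_mem.2 (hxI x hx), map_zero]
  have hle := ringKrullDim_le_of_surjective (Ideal.Quotient.lift _ φ hker)
    (Ideal.Quotient.lift_surjective_of_surjective _ hker hφ)
  rw [IsLocalization.AtPrime.ringKrullDim_eq_height p (Localization.AtPrime p)] at hle
  rw [IsLocalization.AtPrime.ringKrullDim_eq_height P S, List.length_map] at hdim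
  have : (p.height : WithBot ℕ∞) + xs.length ≤ P.height := by
    rw [← hdim]
    gcongr
  exact_mod_cast this

variable [IsLocalRing A]
  (hvan : ∀ (P : Ideal A) [P.IsPrime] (i : ℕ), (i : ℕ∞) < P.height →
    Subsingleton (ExtMod A (A ⧸ P) A i))

include hvan

/-- Ext^i(A/P, A) vanishes below ht P, hence Ext^i(A/P, A/(xs)) vanishes for i < k; apply Rees's
criterion. -/
theorem exists_isWeaklyRegular_quotient (P : Ideal A) [P.IsPrime] (hIP : I ≤ P) (k : ℕ)
    (hk : k + xs.length ≤ P.height) : ∃ ys : List A, ys.length = k ∧ (∀ y ∈ ys, y ∈ P) ∧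
      IsWeaklyRegular (A ⧸ (Ideal.ofList xs • ⊤ : Submodule A A)) ys := by
  have hreg := (isRegular_iff_isWeaklyRegular_of_subset_maximalIdeal (M := A)
    fun x hx => le_maximalIdeal_of_isPrime P (hIP (hxI x hx))).2 hxs
  have : Nontrivial (A ⧸ (Ideal.ofList xs • ⊤ : Submodule A A)) :=
    Submodule.Quotient.nontrivial_iff.2 hreg.top_ne_smul.symm
  have hlt : P • (⊤ : Submodule A (A ⧸ (Ideal.ofList xs • ⊤ : Submodule A A))) < ⊤ :=
    lt_top_iff_ne_top.2 (Submodule.top_ne_ideal_smul_of_le_jacobson_annihilator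
      ((le_maximalIdeal_of_isPrime P).trans (maximalIdeal_le_jacobson _))).symm
  obtain ⟨ys, hlen, hmem, hys⟩ := ModuleCat.exists_isRegular_of_exists_subsingleton_ext P k
    (ModuleCat.of A (A ⧸ (Ideal.ofList xs • ⊤ : Submodule A A))) hlt (ModuleCat.of A (A ⧸ P))
    (by
      rw [Module.support_eq_zeroLocus]
      exact congrArg (fun I : Ideal A => PrimeSpectrum.zeroLocus (I : Set A))
        Ideal.annihilator_quotient)
    (fun i hi => subsingleton_ext_quotient_of_isWeaklyRegular xs hxs (k + xs.length)
      (fun j hj => hvan P j (lt_of_lt_of_le (by exact_mod_cast hj) hk)) i (by omega))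
  exact ⟨ys, hlen, hmem, hys.toIsWeaklyRegular⟩

/-- The regular sequence, of length min(2, ht p), is found in the preimage of p over A, carried to
Hom and only then localized, which preserves weak regularity. -/
theorem satisfiesSerre_two_of_equiv_hom {N Q : Type u} [AddCommGroup N] [Module A N]
    [AddCommGroup Q] [Module A Q] [Module (A ⧸ I) Q] [IsScalarTower A (A ⧸ I) Q]
    (e : Q ≃ₗ[A] (N →ₗ[A] A ⧸ (Ideal.ofList xs • ⊤ : Submodule A A))) :
    SatisfiesSerre 2 (A ⧸ I) Q := by
  intro p _
  rw [IsLocalization.AtPrime.ringKrullDim_eq_height p]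
  obtain ⟨k, hk⟩ : ∃ k : ℕ, (k : ℕ∞) = min 2 p.height :=
    ENat.ne_top_iff_exists.1 (ne_top_of_le_ne_top (ENat.natCast_ne_top 2) (min_le_left _ _))
  have hmin : min ((2 : ℕ) : WithBot ℕ∞) (p.height : WithBot ℕ∞) = ((k : ℕ∞) : WithBot ℕ∞) := by
    rw [hk, WithBot.coe_min]
    rfl
  rw [hmin, WithBot.coe_le_coe]
  have hk2 : k ≤ 2 := by
    have : (k : ℕ∞) ≤ (2 : ℕ) := hk.trans_le (min_le_left _ _)
    exact_mod_cast this
  have hkp : (k : ℕ∞) ≤ p.height := hk.trans_le (min_le_right _ _)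
  obtain ⟨ys, hlen, hmem, hys⟩ := exists_isWeaklyRegular_quotient hxs hxI hvan
    (p.comap (Ideal.Quotient.mk I)) (fun a ha => by
      rw [Ideal.mem_comap, Ideal.Quotient.eq_zero_iff_mem.2 ha]
      exact p.zero_mem) k
    ((add_le_add_left hkp _).trans (height_add_length_le_height_comap hxs hxI p))
  have hQ : IsWeaklyRegular Q ys :=
    (e.isWeaklyRegular_congr ys).2 (isWeaklyRegular_linearMap (hlen.trans_le hk2) hys)
  have hloc := ((isWeaklyRegular_map_algebraMap_iff (A ⧸ I) Q ys).2 hQ).of_isLocalizedModule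
    (Localization.AtPrime p) p.primeCompl (LocalizedModule.mkLinearMap p.primeCompl Q)
  refine (le_grade_iff k).2 ⟨_, ?_, ?_, hloc⟩
  · rw [List.length_map, List.length_map, hlen]
  · intro z hz
    obtain ⟨w, hw, rfl⟩ := List.mem_map.1 hz
    obtain ⟨y, hy, rfl⟩ := List.mem_map.1 hw
    exact (IsLocalization.AtPrime.to_map_mem_maximal_iff (Localization.AtPrime p) p _).2 (hmem y hy)

end Serre

end KoszulHomology

end

theorem theorem1p12 {A : Type u} [CommRing A] [IsLocalRing A]
    (hA : KoszulHomology.IsGorensteinLocalRing A)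
    (I : Ideal A) (g : ℕ) (hg : KoszulHomology.grade I A = (g : ℕ∞))
    (m : ℕ) (u : Fin m → A) (hu : KoszulHomology.IsMinimalGenerators u I)
    (r : ℕ) (hr : 1 ≤ r)
    (hCM : ∀ i < r, KoszulHomology.IsCohenMacaulay A (KoszulHomology.koszulHomology u i)) :
    Nonempty (KoszulHomology.koszulCohomology u (r + g) ≃ₗ[A]
      CategoryTheory.Abelian.Ext (KoszulHomology.koszulHomology u r) (ModuleCat.of A A) g) ∧
    ∃ hI : Module.IsTorsionBySet A (KoszulHomology.koszulCohomology u (r + g)) I,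
      letI : Module (A ⧸ I) (KoszulHomology.koszulCohomology u (r + g)) := hI.module
      KoszulHomology.SatisfiesSerre 2 (A ⧸ I) (KoszulHomology.koszulCohomology u (r + g)) := by
  open KoszulHomology in
  have := hA.isNoetherianRing
  obtain ⟨n, hn⟩ := hA.finite_injectiveDimension
  have hfin : ∃ n : ℕ, ∀ (N : Type u) [AddCommGroup N] [Module A N], ∀ j, n ≤ j →
      Subsingleton (ExtMod A N A j) :=
    ⟨n + 1, fun N _ _ j hj => HasInjectiveDimensionLT.subsingleton _ (n + 1) j hj _⟩
  obtain ⟨rs, hm, hrs, hmax⟩ := exists_maximal_isWeaklyRegular (A := A)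
  obtain ⟨xs, rfl, hxI, hxs⟩ := (le_grade_iff g).1 hg.ge
  obtain rfl := hu.span_eq
  obtain ⟨eH⟩ := nonempty_koszulHomology_equiv u r
  obtain ⟨eC⟩ := nonempty_koszulCohomology_equiv u (r + xs.length)
  obtain ⟨eE⟩ := nonempty_koszulCohomologyOf_equiv_ext u hxs hxI
    (subsingleton_ext_koszulHomologyOf_of_isCohenMacaulay u hxs hxI hg hm hrs
      (subsingleton_ext_of_length_lt hm hrs hmax hfin)
      (fun i hi => (hCM i hi).of_equiv (nonempty_koszulHomology_equiv u i).some))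
  obtain ⟨eHom⟩ := nonempty_ext_equiv_hom_quotient xs hxs
    (fun x hx => smul_koszulHomologyOf_eq_zero u r (hxI x hx))
  have hI : Module.IsTorsionBySet A (koszulCohomology u (r + xs.length))
      (Ideal.span (Set.range u) : Ideal A) := fun x a => by
    -- I kills H_r, hence Ext^g(H_r, A), and this transports along the isomorphism.
    apply (eC.trans eE).injective
    rw [map_smul, map_zero]
    exact smul_ext_eq_zero_of_smul_eq_zero (smul_koszulHomologyOf_eq_zero u r a.2) _ _
  refine ⟨⟨(eC.trans eE).trans (extCongr eH _)⟩, hI, ?_⟩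
  let : Module (A ⧸ Ideal.span (Set.range u)) (koszulCohomology u (r + xs.length)) := hI.module
  have : IsScalarTower A (A ⧸ Ideal.span (Set.range u)) (koszulCohomology u (r + xs.length)) :=
    hI.isScalarTower
  exact satisfiesSerre_two_of_equiv_hom hxs hxI
    (fun P _ i hi => subsingleton_ext_quotient_of_lt_height hm hrs hmax hfin P i hi)
    ((eC.trans eE).trans eHom)
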